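/- Let $n\ge 0$ be an integer and $1<p<\infty$. Let $F^p=F^p(\mathbb C^n)$ be the space of entire functions $f$ on $\mathbb C^n$ such that $f(w)e^{-|w|^2/2}$ belongs to $L^p(\mathbb C^n,dv)$, where $dv$ is Lebesgue measure, with norm $\|f\|_{F^p}=\big(\int_{\mathbb C^n}|f(w)e^{-|w|^2/2}|^p\,dv(w)\big)^{1/p}$. Write $\langle f,g\rangle_{F^2}=\pi^{-n}\int_{\mathbb C^n}f(w)\overline{g(w)}e^{-|w|^2}\,dv(w)$ (absolutely convergent when $f\in F^p$, $g\in F^q$, $\frac1p+\frac1q=1$), and let $k_z(w)=e^{\bar z\cdot w-|z|^2/2}$, with $\bar z\cdot w=\sum_{i=1}^n\overline{z_i}\,w_i$, be the normalized reproducing kernel of $F^2$ at $z\in\mathbb C^n$. A bounded linear operator $S$ on $F^p$ is called sufficiently localized if there are constants $2n<\beta<\infty$ and $0<C<\infty$ such that $$|\langle Sk_z,k_w\rangle_{F^2}|\le \frac{C}{(1+|z-w|)^{\beta}}\qquad\text{for all } z,w\in\mathbb C^n .$$ Let $T$ be a bounded linear operator on $F^p$ that belongs to the closure, in the operator norm of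 $F^p$, of the set of sufficiently localized operators. If $\lim_{|z|\to\infty}\langle Tk_z,k_z\rangle_{F^2}=0$, then $T$ is compact on $F^p$. -/

import Mathlib

open MeasureTheory Filter Topology
open scoped ENNReal ComplexConjugate

noncomputable section

/-- The space `ℂⁿ` with its Euclidean norm and Lebesgue measure. -/
abbrev Cn (n : ℕ) : Type := EuclideanSpace ℂ (Fin n)

/-- The weighted function `f(w) e^{-|w|²/2}`. -/
def fockWeighted {n : ℕ} (f : Cn n → ℂ) (w : Cn n) : ℂ :=
  f w * (Real.exp (-‖w‖ ^ 2 / 2) : ℂ)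

/-- The vector space of entire functions `f` on `ℂⁿ` such that `f(w) e^{-|w|²/2}` belongs to
`Lᵖ(ℂⁿ, dv)`, where `dv` is Lebesgue measure. -/
def fockSubmodule (n : ℕ) (p : ℝ≥0∞) : Submodule ℂ (Cn n → ℂ) where
  carrier := {f | Differentiable ℂ f ∧ MemLp (fockWeighted f) p volume}
  zero_mem' := by
    refine ⟨differentiable_const 0, ?_⟩
    have h : fockWeighted (0 : Cn n → ℂ) = 0 := by
      funext w; simp [fockWeighted]
    rw [h]; exact MemLp.zero
  add_mem' := by
    rintro f g ⟨hf, hf'⟩ ⟨hg, hg'⟩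
    refine ⟨hf.add hg, ?_⟩
    have h : fockWeighted (f + g) = fockWeighted f + fockWeighted g := by
      funext w; simp [fockWeighted, add_mul]
    rw [h]; exact hf'.add hg'
  smul_mem' := by
    rintro c f ⟨hf, hf'⟩
    refine ⟨hf.const_smul c, ?_⟩
    have h : fockWeighted (c • f) = c • fockWeighted f := by
      funext w; simp [fockWeighted, mul_assoc]
    rw [h]; exact hf'.const_smul c

/-- The Fock space `Fᵖ(ℂⁿ)`.  This is a type of its own, so that its topology is the one of the
norm below and not the topology of pointwise convergence. -/
def FockSpace (n : ℕ) (p : ℝ≥0∞) : Type := fockSubmodule n p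

namespace FockSpace

instance (n : ℕ) (p : ℝ≥0∞) : AddCommGroup (FockSpace n p) :=
  inferInstanceAs (AddCommGroup (fockSubmodule n p))

instance (n : ℕ) (p : ℝ≥0∞) : Module ℂ (FockSpace n p) :=
  inferInstanceAs (Module ℂ (fockSubmodule n p))

instance (n : ℕ) (p : ℝ≥0∞) : CoeFun (FockSpace n p) (fun _ => Cn n → ℂ) :=
  ⟨fun f => f.1⟩

/-- The embedding `f ↦ f e^{-|·|²/2}` of `Fᵖ` into `Lᵖ(ℂⁿ, dv)`. -/
def toLp (n : ℕ) (p : ℝ≥0∞) : FockSpace n p →ₗ[ℂ] Lp ℂ p (volume : Measure (Cn n)) where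
  toFun f := f.2.2.toLp (fockWeighted f)
  map_add' f g := by
    rw [← MemLp.toLp_add]
    refine MemLp.toLp_congr _ _ (Eventually.of_forall fun w => ?_)
    exact add_mul (f w) (g w) _
  map_smul' c f := by
    rw [RingHom.id_apply, ← MemLp.toLp_const_smul]
    refine MemLp.toLp_congr _ _ (Eventually.of_forall fun w => ?_)
    exact mul_assoc c (f w) _

theorem continuous_fockWeighted {n : ℕ} {f : Cn n → ℂ} (hf : Continuous f) :
    Continuous (fockWeighted f) := by
  unfold fockWeighted; fun_prop

theorem toLp_injective (n : ℕ) (p : ℝ≥0∞) : Function.Injective (toLp n p) := by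
  intro f g h
  have h1 : fockWeighted f =ᵐ[volume] fockWeighted g :=
    (MemLp.toLp_eq_toLp_iff f.2.2 g.2.2).1 h
  have h2 : fockWeighted f = fockWeighted g :=
    (continuous_fockWeighted f.2.1.continuous).ae_eq_iff_eq volume
      (continuous_fockWeighted g.2.1.continuous) |>.1 h1
  refine Subtype.ext (funext fun w => ?_)
  have h3 : f w * (Real.exp (-‖w‖ ^ 2 / 2) : ℂ) = g w * (Real.exp (-‖w‖ ^ 2 / 2) : ℂ) :=
    congrFun h2 w
  exact mul_right_cancel₀ (Complex.ofReal_ne_zero.2 (Real.exp_pos _).ne') h3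

/-- The norm of `Fᵖ` is the norm of `f e^{-|·|²/2}` in `Lᵖ(ℂⁿ, dv)`. -/
instance (n : ℕ) (p : ℝ≥0∞) [Fact (1 ≤ p)] : NormedAddCommGroup (FockSpace n p) :=
  NormedAddCommGroup.induced (FockSpace n p) (Lp ℂ p (volume : Measure (Cn n)))
    (toLp n p) (toLp_injective n p)

instance (n : ℕ) (p : ℝ≥0∞) [Fact (1 ≤ p)] : NormedSpace ℂ (FockSpace n p) :=
  NormedSpace.induced ℂ (FockSpace n p) (Lp ℂ p (volume : Measure (Cn n))) (toLp n p)

theorem norm_eq (n : ℕ) (p : ℝ≥0∞) [Fact (1 ≤ p)] (f : FockSpace n p) :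
    ‖f‖ = (eLpNorm (fockWeighted f) p volume).toReal :=
  Lp.norm_toLp (fockWeighted f) f.2.2

end FockSpace

/-- The pairing `⟨f, g⟩ = π⁻ⁿ ∫ f(w) conj(g(w)) e^{-|w|²} dv(w)` of the Fock space `F²(ℂⁿ)`,
normalized so that `e^{⟨w, z⟩}` is the reproducing kernel.  The integral converges absolutely
when `f ∈ Fᵖ` and `g ∈ F^q` for conjugate exponents `p` and `q`, which gives a meaning to the
pairing of an element of `Fᵖ` with a reproducing kernel. -/
def fockInner {n : ℕ} (f g : Cn n → ℂ) : ℂ :=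
  ((Real.pi ^ n)⁻¹ : ℝ) * ∫ w : Cn n, f w * conj (g w) * (Real.exp (-‖w‖ ^ 2) : ℂ)

/-- The reproducing kernel `K_z(w) = e^{z̄ w}` of `F²(ℂⁿ)`, with `z̄ w = ∑ᵢ conj(zᵢ) wᵢ`. -/
def fockKernel {n : ℕ} (z w : Cn n) : ℂ :=
  Complex.exp (∑ i, conj (z i) * w i)

/-- The normalized reproducing kernel `k_z = K_z / ‖K_z‖`, where `‖K_z‖ = K_z(z)^{1/2} =
e^{|z|²/2}` is the norm in `F²(ℂⁿ)`. -/
def fockNormalizedKernel {n : ℕ} (z w : Cn n) : ℂ :=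
  fockKernel z w / (Real.exp (‖z‖ ^ 2 / 2) : ℂ)

theorem norm_fockWeighted_normalizedKernel {n : ℕ} (z w : Cn n) :
    ‖fockWeighted (fockNormalizedKernel z) w‖ = Real.exp (-‖w - z‖ ^ 2 / 2) := by
  have h1 : ∑ i, conj (z i) * w i = inner ℂ z w := by
    simp [PiLp.inner_apply, mul_comm]
  have h2 : ‖w - z‖ ^ 2 = ‖w‖ ^ 2 - 2 * (inner ℂ z w).re + ‖z‖ ^ 2 := by
    have h := @norm_sub_sq ℂ _ _ _ _ w z
    rw [inner_re_symm] at h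
    simpa using h
  rw [fockWeighted, fockNormalizedKernel, fockKernel, h1, norm_mul, norm_div, Complex.norm_exp,
    Complex.norm_real, Complex.norm_real, Real.norm_of_nonneg (Real.exp_pos _).le,
    Real.norm_of_nonneg (Real.exp_pos _).le, ← Real.exp_sub, ← Real.exp_add, h2]
  congr 1
  ring

theorem differentiable_fockNormalizedKernel {n : ℕ} (z : Cn n) :
    Differentiable ℂ (fockNormalizedKernel z) := by
  unfold fockNormalizedKernel fockKernel
  fun_prop

theorem memLp_fockNormalizedKernel {n : ℕ} (p : ℝ≥0∞) (z : Cn n) :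
    MemLp (fockWeighted (fockNormalizedKernel z)) p volume := by
  have hc : AEStronglyMeasurable (fockWeighted (fockNormalizedKernel z))
      (volume : Measure (Cn n)) :=
    (FockSpace.continuous_fockWeighted
      (differentiable_fockNormalizedKernel z).continuous).aestronglyMeasurable
  rcases eq_or_ne p 0 with rfl | h0
  · exact memLp_zero_iff_aestronglyMeasurable.2 hc
  rcases eq_or_ne p ∞ with rfl | htop
  · refine memLp_top_of_bound hc 1 (Eventually.of_forall fun w => ?_)
    rw [norm_fockWeighted_normalizedKernel, Real.exp_le_one_iff]
    have := sq_nonneg ‖w - z‖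
    linarith
  · have hp : 0 < p.toReal := ENNReal.toReal_pos h0 htop
    rw [← integrable_norm_rpow_iff hc h0 htop]
    have hg := GaussianFourier.integrable_cexp_neg_mul_sq_norm_add (V := Cn n)
      (b := ((p.toReal / 2 : ℝ) : ℂ)) (by simpa using hp) 0 0
    refine (hg.norm.comp_sub_right z).congr (Eventually.of_forall fun w => ?_)
    simp only [norm_fockWeighted_normalizedKernel]
    rw [← Real.exp_mul, Complex.norm_exp]
    congr 1
    norm_cast
    simp
    ring

/-- `k_z` as an element of `Fᵖ(ℂⁿ)`. -/
def fockK {n : ℕ} (p : ℝ≥0∞) (z : Cn n) : FockSpace n p :=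
  ⟨fockNormalizedKernel z, differentiable_fockNormalizedKernel z, memLp_fockNormalizedKernel p z⟩

/-- A bounded operator `S` on `Fᵖ(ℂⁿ)` is sufficiently localized (in the sense of Xia and Zheng)
if there are `2n < β < ∞` and `0 < C < ∞` with `|⟨S k_z, k_w⟩| ≤ C / (1 + |z - w|)^β` for all
`z, w ∈ ℂⁿ`. -/
def IsSufficientlyLocalized {n : ℕ} {p : ℝ≥0∞} [Fact (1 ≤ p)]
    (S : FockSpace n p →L[ℂ] FockSpace n p) : Prop :=
  ∃ β C : ℝ, 2 * (n : ℝ) < β ∧ 0 < C ∧ ∀ z w : Cn n,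
    ‖fockInner (S (fockK p z)) (fockNormalizedKernel w)‖ ≤ C / (1 + ‖z - w‖) ^ β

/-- The Berezin transform `z ↦ ⟨T k_z, k_z⟩` of a bounded operator on `Fᵖ(ℂⁿ)`. -/
def berezinTransform {n : ℕ} {p : ℝ≥0∞} [Fact (1 ≤ p)]
    (T : FockSpace n p →L[ℂ] FockSpace n p) (z : Cn n) : ℂ :=
  fockInner (T (fockK p z)) (fockNormalizedKernel z)

end

/-! ### Gaussian mean value property -/

section MeanValue

/-! By the reproducing property (`fockInner_normalizedKernel`), ⟨T k_z, k_w⟩ is the weighted value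
(T k_z)(w) e^{-|w|²/2}, and f is recovered as π⁻ⁿ ∫ ⟨f, k_z⟩ k_z dv(z). Heuristically T is thus an
integral operator with kernel ⟨T k_z, k_w⟩. It suffices to show that, uniformly for ‖f‖ ≤ 1, T f
carries little L^p mass outside a large ball. Inside a ball, weighted evaluations depend
norm-continuously on the point because p > 1, so restriction to the ball is a norm limit of finite
rank operators. Hence T, followed by the isometry into L^p, is a limit of compact operators
(`isCompactOperator_of_forall_tail_le`).

Near the diagonal, smallness comes from analyticity. Up to an exponential factor, ⟨T k_z, k_w⟩ is
holomorphic in w and in the conjugate of z. Joining diagonal values to the value at (z, w) by a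
holomorphic function of one variable t, which is diagonal for real t and reaches (z, w) at t = i, a
normal family argument and the identity theorem turn decay of the Berezin transform into uniform
decay of ⟨T k_z, k_w⟩ on every band |z - w| ≤ R (`exists_forall_norm_offDiagonal_le`).

Far from the diagonal T has no pointwise decay, but a localized S with ‖T - S‖ < δ does. Cut ℂⁿ into
cubes of side d; for w in a given cube let P be the part of the reproducing integral over the
adjacent cubes, and write T f = T P f + S(f - P f) + (T - S) f - (T - S) P f. At w with |w| large,
the first term sees only the band where T has a small kernel, the second only the integrable tail of
the kernel of S; Young's inequality bounds both. The third is at most δ‖f‖. In the fourth P varies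
with the cube, but the norms of P f localize and the neighbourhoods overlap at most 9ⁿ times, so it
is O(δ)‖f‖ with a constant independent of d (`eLpNorm_cubeProj_le`). That independence allows d to
be chosen after S. -/

theorem measurePreserving_circle_smul {n : ℕ} (c : Circle) :
    MeasurePreserving (fun z : Cn n => (c : ℂ) • z) volume volume := by
  let e : Cn n ≃ₗᵢ[ℝ] Cn n :=
    { LinearEquiv.restrictScalars ℝ
        (LinearEquiv.smulOfNeZero ℂ (Cn n) (c : ℂ) c.coe_ne_zero) with
      norm_map' := fun x => by
        change ‖(c : ℂ) • x‖ = ‖x‖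
        rw [norm_smul, Circle.norm_coe, one_mul] }
  exact e.measurePreserving

theorem integral_exp_neg_norm_sq (n : ℕ) :
    ∫ z : Cn n, Real.exp (-‖z‖ ^ 2) = Real.pi ^ n := by
  have h := GaussianFourier.integral_rexp_neg_mul_sq_norm (V := Cn n) one_pos
  have h2 : (Module.finrank ℝ (Cn n) / 2 : ℝ) = n := by
    rw [finrank_real_of_complex]; simp
  rw [h2, div_one, Real.rpow_natCast] at h
  simpa using h

theorem integral_circle_of_differentiable {n : ℕ} {f : Cn n → ℂ} (hf : Differentiable ℂ f)
    (z : Cn n) :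
    ∫ θ in (0 : ℝ)..2 * Real.pi, f ((Circle.exp θ : ℂ) • z) = 2 * Real.pi * f 0 := by
  have hg : Differentiable ℂ (fun t : ℂ => f (t • z)) := by fun_prop
  have h := (hg.diffContOnCl (s := Metric.ball 0 |1|)).circleAverage
  rw [Real.circleAverage] at h
  simp only [circleMap, zero_add, zero_smul, Complex.ofReal_one, one_mul] at h
  simp only [Circle.coe_exp]
  rw [← h, Complex.real_smul, Complex.ofReal_inv, Complex.ofReal_mul, ← mul_assoc,
    Complex.ofReal_ofNat, mul_inv_cancel₀, one_mul]
  simp [Real.pi_ne_zero]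

/-- The Gaussian mean value property of entire functions. -/
theorem integral_mul_exp_neg_norm_sq {n : ℕ} {f : Cn n → ℂ} (hf : Differentiable ℂ f)
    (hi : Integrable fun z => f z * (Real.exp (-‖z‖ ^ 2) : ℂ)) :
    ∫ z, f z * (Real.exp (-‖z‖ ^ 2) : ℂ) = Real.pi ^ n * f 0 := by
  set F : Cn n → ℂ := fun z => f z * (Real.exp (-‖z‖ ^ 2) : ℂ) with hF
  have hfc := hf.continuous
  have hFc : Continuous F := by fun_prop
  -- Lebesgue measure is rotation invariant, so the integral equals its average over the circle
  -- action. After Fubini, the weight is constant on each orbit and the one-variable mean value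
  -- property replaces f by f 0.
  have hrot : ∀ θ : ℝ, ∫ z, F ((Circle.exp θ : ℂ) • z) = ∫ z, F z := fun θ =>
    (measurePreserving_circle_smul (n := n) (Circle.exp θ)).integral_comp'
      (f := (Homeomorph.smulOfNeZero (Circle.exp θ : ℂ)
        (Circle.exp θ).coe_ne_zero).toMeasurableEquiv) F
  have hrotn : ∀ θ : ℝ, ∫ z, ‖F ((Circle.exp θ : ℂ) • z)‖ = ∫ z, ‖F z‖ := fun θ =>
    (measurePreserving_circle_smul (n := n) (Circle.exp θ)).integral_comp'
      (f := (Homeomorph.smulOfNeZero (Circle.exp θ : ℂ)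
        (Circle.exp θ).coe_ne_zero).toMeasurableEquiv) (fun z => ‖F z‖)
  have hcont : Continuous (Function.uncurry fun (θ : ℝ) (z : Cn n) =>
      F ((Circle.exp θ : ℂ) • z)) := by
    simp only [Function.uncurry_def]
    fun_prop
  have hint : Integrable (Function.uncurry fun (θ : ℝ) (z : Cn n) => F ((Circle.exp θ : ℂ) • z))
      ((volume.restrict (Set.uIoc 0 (2 * Real.pi))).prod volume) := by
    rw [integrable_prod_iff hcont.aestronglyMeasurable]
    constructor
    · refine Eventually.of_forall fun θ => ?_
      exact (measurePreserving_circle_smul (n := n) (Circle.exp θ)).integrable_comp_of_integrable hi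
    · simp only [Function.uncurry_apply_pair, hrotn]
      rw [Set.uIoc_of_le Real.two_pi_pos.le]
      exact integrable_const _
  have h1 := intervalIntegral_integral_swap hint
  have h2 : ∀ z : Cn n, ∫ θ in (0 : ℝ)..2 * Real.pi, F ((Circle.exp θ : ℂ) • z) =
      2 * Real.pi * f 0 * (Real.exp (-‖z‖ ^ 2) : ℂ) := fun z => by
    simp only [hF, norm_smul, Circle.norm_coe, one_mul]
    rw [intervalIntegral.integral_mul_const, integral_circle_of_differentiable hf]
  simp only [hrot, h2] at h1
  rw [intervalIntegral.integral_const, integral_const_mul, integral_complex_ofReal,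
    integral_exp_neg_norm_sq, Complex.real_smul] at h1
  have hpi : (Real.pi : ℂ) ≠ 0 := by simp [Real.pi_ne_zero]
  push_cast at h1 ⊢
  have h3 : (2 * Real.pi : ℂ) ≠ 0 := by simp [Real.pi_ne_zero]
  apply mul_left_cancel₀ h3
  rw [sub_zero] at h1
  rw [h1]; ring

end MeanValue

/-! ### Reproducing property and bounded evaluations -/

theorem fockKernel_eq_exp_inner {n : ℕ} (z w : Cn n) :
    fockKernel z w = Complex.exp (inner ℂ z w) := by
  simp [fockKernel, PiLp.inner_apply, mul_comm]

theorem fockWeighted_mul_conj {n : ℕ} (f g : Cn n → ℂ) (w : Cn n) :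
    fockWeighted f w * conj (fockWeighted g w) =
      f w * conj (g w) * (Real.exp (-‖w‖ ^ 2) : ℂ) := by
  have : Real.exp (-‖w‖ ^ 2) = Real.exp (-‖w‖ ^ 2 / 2) * Real.exp (-‖w‖ ^ 2 / 2) := by
    rw [← Real.exp_add]; ring_nf
  rw [fockWeighted, fockWeighted, map_mul, Complex.conj_ofReal, this]
  push_cast
  ring

theorem fockInner_eq {n : ℕ} (f g : Cn n → ℂ) :
    fockInner f g =
      ((Real.pi ^ n)⁻¹ : ℝ) * ∫ w : Cn n, fockWeighted f w * conj (fockWeighted g w) := by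
  simp only [fockInner, fockWeighted_mul_conj]

theorem MeasureTheory.MemLp.conj {α : Type*} [MeasurableSpace α] {μ : Measure α} {p : ℝ≥0∞}
    {f : α → ℂ} (hf : MemLp f p μ) : MemLp (fun x => conj (f x)) p μ := by
  exact hf.star

namespace FockSpace

variable {n : ℕ} {p q : ℝ≥0∞}

theorem differentiable (f : FockSpace n p) : Differentiable ℂ f := f.2.1

theorem memLp (f : FockSpace n p) : MemLp (fockWeighted f) p volume := f.2.2

theorem continuous_weighted (f : FockSpace n p) : Continuous (fockWeighted f) :=
  continuous_fockWeighted f.differentiable.continuous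

theorem integrable_mul_conj [p.HolderConjugate q] {g : Cn n → ℂ} (f : FockSpace n p)
    (hg : MemLp (fockWeighted g) q volume) :
    Integrable fun w => fockWeighted f w * conj (fockWeighted g w) :=
  f.memLp.integrable_mul hg.conj

/-- The reproducing property of the kernels `k_z`. -/
theorem fockInner_normalizedKernel [Fact (1 ≤ p)] (f : FockSpace n p) (w : Cn n) :
    fockInner f (fockNormalizedKernel w) = fockWeighted f w := by
  have := ENNReal.HolderConjugate.conjExponent (Fact.out : 1 ≤ p)
  have hint := f.integrable_mul_conj (memLp_fockNormalizedKernel p.conjExponent w)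
  -- Translating by w completes the square in the Gaussian: the integrand becomes a constant times
  -- g(z) e^{-|z|²} with g entire and g 0 = f w, so the mean value property applies.
  set g : Cn n → ℂ := fun z => f (z + w) * Complex.exp (-inner ℂ w z) with hg
  have hgd : Differentiable ℂ g := by
    have := f.differentiable
    have h2 : Differentiable ℂ fun z : Cn n => inner ℂ w z :=
      (innerSL ℂ w).differentiable
    fun_prop
  have key : ∀ z, fockWeighted f (z + w) * conj (fockWeighted (fockNormalizedKernel w) (z + w)) =
      g z * (Real.exp (-‖z‖ ^ 2) : ℂ) * (Real.exp (-‖w‖ ^ 2 / 2) : ℂ) := fun z => by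
    have hn : (‖z + w‖ ^ 2 : ℂ) = ‖z‖ ^ 2 + inner ℂ z w + inner ℂ w z + ‖w‖ ^ 2 := by
      have := inner_self_eq_norm_sq_to_K (𝕜 := ℂ) (z + w)
      rw [inner_add_add_self] at this
      rw [inner_self_eq_norm_sq_to_K, inner_self_eq_norm_sq_to_K] at this
      simpa using this.symm
    have hww : inner ℂ w w = (‖w‖ ^ 2 : ℂ) := inner_self_eq_norm_sq_to_K (𝕜 := ℂ) w
    rw [fockWeighted_mul_conj, fockNormalizedKernel, fockKernel_eq_exp_inner, hg, map_div₀,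
      Complex.conj_ofReal, ← Complex.exp_conj, inner_conj_symm]
    push_cast
    rw [hn, div_eq_mul_inv, ← Complex.exp_neg]
    simp only [mul_assoc, ← Complex.exp_add]
    congr 2
    rw [inner_add_left, hww]
    ring
  rw [fockInner_eq, ← integral_add_right_eq_self _ w]
  have hint2 := hint.comp_add_right w
  simp only [key] at hint2 ⊢
  have hint3 : Integrable fun z => g z * (Real.exp (-‖z‖ ^ 2) : ℂ) := by
    have := hint2.mul_const ((Real.exp (-‖w‖ ^ 2 / 2) : ℂ)⁻¹)
    refine this.congr (Eventually.of_forall fun z => ?_)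
    exact mul_inv_cancel_right₀ (Complex.ofReal_ne_zero.2 (Real.exp_pos _).ne') _
  rw [integral_mul_const, integral_mul_exp_neg_norm_sq hgd hint3, hg]
  simp only [zero_add, inner_zero_right, neg_zero, Complex.exp_zero, mul_one, fockWeighted]
  push_cast
  have hpi : (Real.pi : ℂ) ^ n ≠ 0 := by simp [Real.pi_ne_zero]
  field_simp

theorem eLpNorm_eq [Fact (1 ≤ p)] (f : FockSpace n p) :
    eLpNorm (fockWeighted f) p volume = ENNReal.ofReal ‖f‖ := by
  rw [norm_eq, ENNReal.ofReal_toReal f.memLp.eLpNorm_ne_top]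

theorem norm_fockInner_le [Fact (1 ≤ p)] [Fact (1 ≤ q)] [p.HolderConjugate q]
    (f : FockSpace n p) (g : FockSpace n q) : ‖fockInner f g‖ ≤ (Real.pi ^ n)⁻¹ * (‖f‖ * ‖g‖) := by
  rw [fockInner_eq, norm_mul, Complex.norm_real, Real.norm_of_nonneg (by positivity)]
  gcongr
  refine (norm_integral_le_lintegral_norm _).trans ?_
  refine ENNReal.toReal_le_of_le_ofReal (by positivity) ?_
  have h := eLpNorm_le_eLpNorm_mul_eLpNorm_of_nnnorm (p := p) (q := q) (r := 1)
    f.memLp.1 g.memLp.1 (fun a b => a * conj b) 1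
    (Eventually.of_forall fun x => by simp)
  rw [eLpNorm_one_eq_lintegral_enorm, eLpNorm_eq, eLpNorm_eq] at h
  rw [ENNReal.ofReal_mul (norm_nonneg _)]
  simpa [ofReal_norm] using h

/-- The weighted modulus of k_z is a Gaussian centred at z, so translation invariance removes z. -/
theorem norm_fockK [Fact (1 ≤ p)] (z : Cn n) : ‖fockK p z‖ = ‖fockK p (0 : Cn n)‖ := by
  have h : ∀ z : Cn n, eLpNorm (fockWeighted (fockNormalizedKernel z)) p volume =
      eLpNorm (fun w : Cn n => Real.exp (-‖w‖ ^ 2 / 2)) p volume := fun z => by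
    have hm := measurePreserving_sub_right (volume : Measure (Cn n)) z
    rw [← eLpNorm_comp_measurePreserving (g := fun w : Cn n => Real.exp (-‖w‖ ^ 2 / 2))
      (Continuous.aestronglyMeasurable (by fun_prop)) hm]
    refine eLpNorm_congr_norm_ae (Eventually.of_forall fun w => ?_)
    rw [norm_fockWeighted_normalizedKernel]
    simp
  simp only [norm_eq]
  change (eLpNorm (fockWeighted (fockNormalizedKernel z)) p volume).toReal =
    (eLpNorm (fockWeighted (fockNormalizedKernel 0)) p volume).toReal
  rw [h, h]

/-- Evaluations at points, with the Gaussian weight, are uniformly bounded on `Fᵖ`. -/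
theorem exists_norm_fockWeighted_le (n : ℕ) (p : ℝ≥0∞) [Fact (1 ≤ p)] :
    ∃ C : ℝ, 0 < C ∧ ∀ (f : FockSpace n p) (w : Cn n), ‖fockWeighted f w‖ ≤ C * ‖f‖ := by
  have := ENNReal.HolderConjugate.conjExponent (Fact.out : 1 ≤ p)
  have : Fact (1 ≤ p.conjExponent) :=
    ⟨ENNReal.HolderConjugate.one_le p.conjExponent p⟩
  refine ⟨(Real.pi ^ n)⁻¹ * ‖fockK p.conjExponent (0 : Cn n)‖ + 1, by positivity, fun f w => ?_⟩
  have h := norm_fockInner_le f (fockK p.conjExponent w)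
  rw [norm_fockK] at h
  have h2 := f.fockInner_normalizedKernel w
  rw [← h2]
  refine h.trans ?_
  rw [add_mul, one_mul, mul_assoc, mul_comm ‖f‖]
  linarith [norm_nonneg f]

end FockSpace

/-! ### Locally uniform limits of entire functions -/

section Weierstrass

variable {E : Type*} [NormedAddCommGroup E] [NormedSpace ℂ E]

/-- Cauchy's estimate for the derivative of an entire function on a normed space. -/
theorem norm_fderiv_le_of_forall_mem_closedBall {f : E → ℂ} (hf : Differentiable ℂ f) {x : E}
    {M : ℝ} (hM : ∀ y ∈ Metric.closedBall x 1, ‖f y‖ ≤ M) : ‖fderiv ℂ f x‖ ≤ M := by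
  have hM0 : 0 ≤ M := (norm_nonneg _).trans (hM x (Metric.mem_closedBall_self zero_le_one))
  refine ContinuousLinearMap.opNorm_le_bound _ hM0 fun v => ?_
  rcases eq_or_ne v 0 with rfl | hv
  · simp
  have hv' : 0 < ‖v‖ := norm_pos_iff.2 hv
  have hg : Differentiable ℂ (fun t : ℂ => f (x + t • v)) := by fun_prop
  have hd : deriv (fun t : ℂ => f (x + t • v)) 0 = fderiv ℂ f x v := by
    have h1 : HasDerivAt (fun t : ℂ => x + t • v) v 0 := by
      simpa using ((hasDerivAt_id (0 : ℂ)).smul_const v).const_add x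
    have h2 : HasFDerivAt f (fderiv ℂ f x) (x + (0 : ℂ) • v) := by
      simpa using (hf x).hasFDerivAt
    exact (h2.comp_hasDerivAt (0 : ℂ) h1).deriv
  -- One-variable Cauchy estimate on the circle of radius 1/‖v‖, whose image under t ↦ x + t v lies
  -- in the unit ball around x.
  have h := Complex.norm_deriv_le_of_forall_mem_sphere_norm_le (C := M) (c := 0)
    (inv_pos.2 hv') hg.diffContOnCl fun t ht => hM _ (by
      rw [mem_sphere_zero_iff_norm] at ht
      simp [Metric.mem_closedBall, dist_eq_norm, norm_smul, ht, hv'.ne'])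
  rw [hd, div_inv_eq_mul] at h
  exact h

/-- Weierstrass' theorem for entire functions on a normed space. -/
theorem differentiable_of_uniformCauchySeqOn {u : ℕ → E → ℂ} {f : E → ℂ}
    (hu : ∀ m, Differentiable ℂ (u m)) (hlim : ∀ x, Tendsto (fun m => u m x) atTop (𝓝 (f x)))
    (hc : ∀ R, UniformCauchySeqOn u atTop (Metric.closedBall 0 R)) : Differentiable ℂ f := by
  intro x
  -- Cauchy's estimate on unit balls transfers the uniform Cauchy property to derivatives; the
  -- radius ‖x‖ + 2 contains every unit ball centred within distance 1 of x.
  have hd : UniformCauchySeqOn (fun m => fderiv ℂ (u m)) atTop (Metric.ball x 1) := by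
    rw [Metric.uniformCauchySeqOn_iff]
    intro ε hε
    obtain ⟨N, hN⟩ := Metric.uniformCauchySeqOn_iff.1 (hc (‖x‖ + 2)) (ε / 2) (half_pos hε)
    refine ⟨N, fun m hm k hk y hy => ?_⟩
    rw [dist_eq_norm, ← fderiv_sub (hu m y) (hu k y)]
    refine (norm_fderiv_le_of_forall_mem_closedBall (M := ε / 2)
      ((hu m).sub (hu k)) fun z hz => ?_).trans_lt (half_lt_self hε)
    rw [Pi.sub_apply, ← dist_eq_norm]
    refine (hN m hm k hk z ?_).le
    rw [mem_closedBall_zero_iff]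
    have h1 : ‖z - y‖ ≤ 1 := mem_closedBall_iff_norm.1 hz
    have h2 : ‖y - x‖ < 1 := mem_ball_iff_norm.1 hy
    have h3 := norm_add₃_le (a := z - y) (b := y - x) (c := x)
    rw [sub_add_sub_cancel, sub_add_cancel] at h3
    linarith
  have hl : ∀ y ∈ Metric.ball x 1, ∃ L, Tendsto (fun m => fderiv ℂ (u m) y) atTop (𝓝 L) :=
    fun y hy => cauchySeq_tendsto_of_complete (hd.cauchySeq hy)
  choose! g' hg' using hl
  have hunif := hd.tendstoUniformlyOn_of_tendsto hg'
  have hfil : TendstoUniformlyOnFilter (fun m => fderiv ℂ (u m)) g' atTop (𝓝 x) :=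
    (tendstoUniformlyOn_iff_tendstoUniformlyOnFilter.1 hunif).mono_right
      (le_principal_iff.2 (Metric.ball_mem_nhds x one_pos))
  exact (hasFDerivAt_of_tendstoUniformlyOnFilter hfil
    (Eventually.of_forall fun m => (hu m.1 m.2).hasFDerivAt)
    (Eventually.of_forall hlim)).differentiableAt

end Weierstrass

/-! ### Functions of exponential type and completeness of the Fock space -/

/-- Since (t/2 - B)² ≥ 0, one has B t - t²/2 ≤ B² - t²/4, which leaves a Gaussian. -/
theorem memLp_exp_linear_sub_sq (n : ℕ) {p : ℝ≥0∞} (h0 : p ≠ 0) (htop : p ≠ ∞) (B : ℝ) :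
    MemLp (fun w : Cn n => Real.exp (B * ‖w‖) * Real.exp (-‖w‖ ^ 2 / 2)) p volume := by
  have hp : 0 < p.toReal := ENNReal.toReal_pos h0 htop
  have h1 : MemLp (fun w : Cn n => Real.exp (-‖w‖ ^ 2 / 4)) p volume := by
    rw [← integrable_norm_rpow_iff (Continuous.aestronglyMeasurable (by fun_prop)) h0 htop]
    have hg := GaussianFourier.integrable_cexp_neg_mul_sq_norm_add (V := Cn n)
      (b := ((p.toReal / 4 : ℝ) : ℂ)) (by simpa using hp) 0 0
    refine hg.norm.congr (Eventually.of_forall fun w => ?_)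
    simp only
    rw [Real.norm_of_nonneg (Real.exp_pos _).le, ← Real.exp_mul, Complex.norm_exp]
    congr 1
    norm_cast
    simp
    ring
  refine (h1.const_mul (Real.exp (B ^ 2))).mono (Continuous.aestronglyMeasurable (by fun_prop))
    (Eventually.of_forall fun w => ?_)
  rw [← Real.exp_add, ← Real.exp_add, Real.norm_of_nonneg (Real.exp_pos _).le,
    Real.norm_of_nonneg (Real.exp_pos _).le, Real.exp_le_exp]
  nlinarith [sq_nonneg (‖w‖ / 2 - B)]

namespace FockSpace

variable {n : ℕ} {p : ℝ≥0∞}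

/-- Entire functions of exponential type belong to `Fᵖ`, with control of the norm. -/
theorem exists_norm_le_of_growth (n : ℕ) (p : ℝ≥0∞) [Fact (1 ≤ p)] (htop : p ≠ ∞) (B : ℝ) :
    ∃ G : ℝ, 0 ≤ G ∧ ∀ (A : ℝ) (f : Cn n → ℂ), 0 ≤ A → Differentiable ℂ f →
      (∀ w, ‖f w‖ ≤ A * Real.exp (B * ‖w‖)) →
      ∃ h : FockSpace n p, (∀ w, h w = f w) ∧ ‖h‖ ≤ A * G := by
  have h0 : p ≠ 0 := (zero_lt_one.trans_le (Fact.out : 1 ≤ p)).ne'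
  have hm := memLp_exp_linear_sub_sq n h0 htop B
  refine ⟨(eLpNorm (fun w : Cn n => Real.exp (B * ‖w‖) * Real.exp (-‖w‖ ^ 2 / 2)) p
    volume).toReal, ENNReal.toReal_nonneg, fun A f hA hf hb => ?_⟩
  have hle : ∀ w, ‖fockWeighted f w‖ ≤
      A * ‖Real.exp (B * ‖w‖) * Real.exp (-‖w‖ ^ 2 / 2)‖ := fun w => by
    rw [fockWeighted, norm_mul, Complex.norm_real, Real.norm_of_nonneg (Real.exp_pos _).le,
      Real.norm_of_nonneg (by positivity), ← mul_assoc]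
    exact mul_le_mul_of_nonneg_right (hb w) (Real.exp_pos _).le
  have hmem : MemLp (fockWeighted f) p volume :=
    hm.of_le_mul (continuous_fockWeighted hf.continuous).aestronglyMeasurable
      (Eventually.of_forall hle)
  refine ⟨⟨f, hf, hmem⟩, fun w => rfl, ?_⟩
  refine (norm_eq n p _).trans_le (ENNReal.toReal_le_of_le_ofReal (by positivity) ?_)
  rw [ENNReal.ofReal_mul hA, ENNReal.ofReal_toReal hm.eLpNorm_ne_top]
  exact eLpNorm_le_mul_eLpNorm_of_ae_le_mul (Eventually.of_forall hle) p

/-- The isometric embedding `f ↦ f e^{-|·|²/2}` of `Fᵖ` into `Lᵖ`. -/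
noncomputable def toLpₗᵢ (n : ℕ) (p : ℝ≥0∞) [Fact (1 ≤ p)] :
    FockSpace n p →ₗᵢ[ℂ] Lp ℂ p (volume : Measure (Cn n)) where
  toLinearMap := toLp n p
  norm_map' _ := rfl

theorem coeFn_toLpₗᵢ [Fact (1 ≤ p)] (f : FockSpace n p) :
    toLpₗᵢ n p f =ᵐ[volume] fockWeighted f :=
  MemLp.coeFn_toLp f.2.2

theorem fockWeighted_sub (f g : FockSpace n p) (w : Cn n) :
    fockWeighted (f - g : FockSpace n p) w = fockWeighted f w - fockWeighted g w :=
  sub_mul (f w) (g w) _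

theorem apply_eq_fockWeighted_mul (f : Cn n → ℂ) (w : Cn n) :
    f w = fockWeighted f w * (Real.exp (‖w‖ ^ 2 / 2) : ℂ) := by
  rw [fockWeighted, mul_assoc, ← Complex.ofReal_mul, ← Real.exp_add]
  ring_nf
  simp

/-- Bounded evaluations make a Cauchy sequence locally uniformly Cauchy, so its pointwise limit is
entire; an almost everywhere convergent subsequence identifies it with the L^p limit. Completeness
supports kernel series, vector-valued integrals, and the closed embedding into L^p. -/
instance [Fact (1 ≤ p)] : CompleteSpace (FockSpace n p) := by
  refine Metric.complete_of_cauchySeq_tendsto fun u hu => ?_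
  obtain ⟨C, hC, hev⟩ := exists_norm_fockWeighted_le n p
  have hdist : ∀ m k w, dist (u m w) (u k w) ≤
      C * dist (u m) (u k) * Real.exp (‖w‖ ^ 2 / 2) := fun m k w => by
    have h := hev (u m - u k) w
    rw [dist_eq_norm, dist_eq_norm]
    have h2 := apply_eq_fockWeighted_mul (u m - u k : FockSpace n p) w
    change u m w - u k w = _ at h2
    rw [h2, norm_mul, Complex.norm_real, Real.norm_of_nonneg (Real.exp_pos _).le]
    gcongr
  have hc : ∀ R, UniformCauchySeqOn (fun m => (u m : Cn n → ℂ)) atTop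
      (Metric.closedBall 0 R) := fun R => by
    rw [Metric.uniformCauchySeqOn_iff]
    intro ε hε
    have hpos : 0 < C * Real.exp (R ^ 2 / 2) := by positivity
    obtain ⟨N, hN⟩ := Metric.cauchySeq_iff.1 hu (ε / (C * Real.exp (R ^ 2 / 2))) (by positivity)
    refine ⟨N, fun m hm k hk w hw => (hdist m k w).trans_lt ?_⟩
    have hw' := mem_closedBall_zero_iff.1 hw
    have h1 := hN m hm k hk
    rw [lt_div_iff₀ hpos] at h1
    refine lt_of_le_of_lt ?_ h1
    rw [mul_comm C, mul_assoc]
    gcongr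
  have hl : ∀ w, ∃ L, Tendsto (fun m => u m w) atTop (𝓝 L) := fun w =>
    cauchySeq_tendsto_of_complete
      ((hc ‖w‖).cauchySeq (by simp [Metric.mem_closedBall]))
  choose f hf using hl
  have hfd : Differentiable ℂ f :=
    differentiable_of_uniformCauchySeqOn (fun m => (u m).differentiable) hf hc
  have hcL : CauchySeq fun m => toLpₗᵢ n p (u m) :=
    hu.map (toLpₗᵢ n p).isometry.uniformContinuous
  obtain ⟨G, hG⟩ := cauchySeq_tendsto_of_complete hcL
  obtain ⟨ns, hns, hae⟩ := (tendstoInMeasure_of_tendsto_Lp hG).exists_seq_tendsto_ae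
  have hGf : G =ᵐ[volume] fockWeighted f := by
    have hall : ∀ᵐ w, ∀ m, toLpₗᵢ n p (u m) w = fockWeighted (u m) w :=
      ae_all_iff.2 fun m => coeFn_toLpₗᵢ (u m)
    filter_upwards [hae, hall] with w h1 h2
    simp only [h2] at h1
    exact tendsto_nhds_unique h1
      (((hf w).mul_const ((Real.exp (-‖w‖ ^ 2 / 2) : ℝ) : ℂ)).comp hns.tendsto_atTop)
  let F : FockSpace n p := ⟨f, hfd, (memLp_congr_ae hGf).1 (Lp.memLp G)⟩
  refine ⟨F, ?_⟩
  have hFG : toLpₗᵢ n p F = G := Lp.ext ((coeFn_toLpₗᵢ F).trans hGf.symm)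
  rw [(toLpₗᵢ n p).isometry.isEmbedding.tendsto_nhds_iff, hFG]
  exact hG

end FockSpace

/-! ### A normal family argument on the disc -/

section NormalFamilies

/-- A family of entire functions which is bounded on a disc and tends to zero at all real points
tends to zero at `I`. -/
theorem tendsto_apply_I_of_tendsto_real {ι : Type*} {l : Filter ι} {φ : ι → ℂ → ℂ} {M : ℝ}
    (hd : ∀ i, Differentiable ℂ (φ i)) (hb : ∀ᶠ i in l, ∀ t, ‖t‖ ≤ 2 → ‖φ i t‖ ≤ M)
    (hr : ∀ t : ℝ, Tendsto (fun i => φ i t) l (𝓝 0)) :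
    Tendsto (fun i => φ i Complex.I) l (𝓝 0) := by
  -- Along an ultrafilter the bounded Taylor coefficients converge, which replaces extraction of a
  -- subsequence.
  rw [tendsto_iff_ultrafilter]
  intro g hg
  replace hb : ∀ᶠ i in (g : Filter ι), ∀ t, ‖t‖ ≤ 2 → ‖φ i t‖ ≤ M := hg hb
  replace hr := fun t => (hr t).mono_left hg
  set a : ℕ → ι → ℂ := fun k i => (k.factorial : ℂ)⁻¹ * iteratedDeriv k (φ i) 0 with ha
  have hM : 0 ≤ M := by
    obtain ⟨i, hi⟩ := hb.exists
    exact (norm_nonneg _).trans (hi 0 (by simp))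
  have hab : ∀ᶠ i in (g : Filter ι), ∀ k, ‖a k i‖ ≤ M / 2 ^ k := by
    filter_upwards [hb] with i hi k
    have h := Complex.norm_iteratedDeriv_le_of_forall_mem_sphere_norm_le (c := 0) k two_pos
      (hd i).diffContOnCl fun t ht => hi t (by simpa using (mem_sphere_zero_iff_norm.1 ht).le)
    rw [ha, norm_mul, norm_inv, Complex.norm_natCast, inv_mul_le_iff₀ (by positivity),
      ← mul_div_assoc]
    exact h
  have hsum : ∀ i t, φ i t = ∑' k, a k i * t ^ k := fun i t => by
    rw [← Complex.taylorSeries_eq_of_entire' 0 t (hd i)]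
    simp [ha]
  have hα : ∀ k, ∃ α, Tendsto (a k) g (𝓝 α) ∧ ‖α‖ ≤ M / 2 ^ k := fun k => by
    have hK := (isCompact_closedBall (0 : ℂ) (M / 2 ^ k)).ultrafilter_le_nhds' (g.map (a k)) (by
      change ∀ᶠ i in (g : Filter ι), a k i ∈ Metric.closedBall (0 : ℂ) (M / 2 ^ k)
      filter_upwards [hab] with i hi
      simpa using hi k)
    obtain ⟨α, h1, h2⟩ := hK
    exact ⟨α, h2, by simpa using h1⟩
  choose α hαl hαb using hα
  -- Bounds on radius 2, used on radius 3/2, leave the summable ratio 3/4; the smaller disc still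
  -- contains `I`.
  have hterm : ∀ (c : ℂ) (k : ℕ) (t : ℂ), ‖c‖ ≤ M / 2 ^ k → ‖t‖ ≤ 3 / 2 →
      ‖c * t ^ k‖ ≤ M * (3 / 4) ^ k := fun c k t hc ht => by
    rw [norm_mul, norm_pow]
    calc ‖c‖ * ‖t‖ ^ k ≤ M / 2 ^ k * (3 / 2) ^ k := by gcongr
      _ = M * (3 / 4) ^ k := by
        rw [div_mul_eq_mul_div, mul_div_assoc, ← div_pow]; norm_num
  have hS : Summable fun k : ℕ => M * (3 / 4 : ℝ) ^ k :=
    (summable_geometric_of_lt_one (by norm_num) (by norm_num)).mul_left M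
  have hlim : ∀ t : ℂ, ‖t‖ ≤ 3 / 2 → Tendsto (fun i => φ i t) g (𝓝 (∑' k, α k * t ^ k)) :=
    fun t ht => by
      simp only [hsum]
      refine tendsto_tsum_of_dominated_convergence hS (fun k => (hαl k).mul_const _) ?_
      filter_upwards [hab] with i hi k
      exact hterm _ _ _ (hi k) ht
  have hΦd : DifferentiableOn ℂ (fun t => ∑' k, α k * t ^ k) (Metric.ball 0 (3 / 2)) :=
    Complex.differentiableOn_tsum_of_summable_norm hS (fun k => by fun_prop) Metric.isOpen_ball
      fun k t ht => hterm _ _ _ (hαb k) (mem_ball_zero_iff.1 ht).le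
  have hΦr : ∀ t : ℝ, |t| ≤ 3 / 2 → ∑' k, α k * (t : ℂ) ^ k = 0 := fun t ht =>
    tendsto_nhds_unique (hlim t (by simpa using ht)) (hr t)
  -- The limit function vanishes at real points accumulating at 0, hence identically by the identity
  -- theorem.
  have hfreq : ∃ᶠ t in 𝓝[≠] (0 : ℂ), ∑' k, α k * t ^ k = 0 := by
    have h1 : Tendsto (fun s : ℝ => (s : ℂ)) (𝓝[≠] 0) (𝓝[≠] 0) := by
      refine tendsto_nhdsWithin_iff.2 ⟨?_, ?_⟩
      · exact (Complex.continuous_ofReal.tendsto' 0 0 (by simp)).mono_left nhdsWithin_le_nhds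
      · filter_upwards [self_mem_nhdsWithin] with s hs
        simpa using hs
    refine h1.frequently (Eventually.frequently ?_)
    have h2 : ∀ᶠ s : ℝ in 𝓝 0, |s| ≤ 3 / 2 :=
      (continuous_abs.tendsto' (0 : ℝ) 0 (by simp)).eventually (eventually_le_nhds (by norm_num))
    filter_upwards [nhdsWithin_le_nhds h2] with s hs using hΦr s hs
  have hzero := (hΦd.analyticOnNhd Metric.isOpen_ball).eqOn_zero_of_preconnected_of_frequently_eq_zero
    (convex_ball _ _).isPreconnected (Metric.mem_ball_self (by norm_num)) hfreq
  have hI := hlim Complex.I (by norm_num)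
  have hI2 := hzero (x := Complex.I) (by simp; norm_num)
  simp only [Pi.zero_apply] at hI2
  rwa [hI2] at hI

end NormalFamilies

/-! ### Continuity of kernels and of evaluations -/

/-- Mean value inequality for exp on a disc, with the extra factor ‖w‖ absorbed by e^{‖w‖}. The
bound has exponential type and a prefactor ‖a - b‖, so it yields continuity of the kernels in the
Fock norm. -/
theorem norm_exp_inner_sub_le {n : ℕ} {a b w : Cn n} {r : ℝ} (ha : ‖a‖ ≤ r) (hb : ‖b‖ ≤ r) :
    ‖Complex.exp (inner ℂ a w) - Complex.exp (inner ℂ b w)‖ ≤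
      ‖a - b‖ * Real.exp ((r + 1) * ‖w‖) := by
  have hmem : ∀ c : Cn n, ‖c‖ ≤ r → inner ℂ c w ∈ Metric.closedBall (0 : ℂ) (r * ‖w‖) :=
    fun c hc => by
      rw [mem_closedBall_zero_iff]
      exact (norm_inner_le_norm c w).trans (by gcongr)
  have h := (convex_closedBall (0 : ℂ) (r * ‖w‖)).norm_image_sub_le_of_norm_deriv_le
    (f := Complex.exp) (C := Real.exp (r * ‖w‖)) (fun x _ => Complex.differentiableAt_exp)
    (fun x hx => by
      rw [Complex.deriv_exp, Complex.norm_exp]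
      exact Real.exp_le_exp.2 ((Complex.re_le_norm x).trans (mem_closedBall_zero_iff.1 hx)))
    (hmem b hb) (hmem a ha)
  refine h.trans ?_
  rw [← inner_sub_left]
  have h1 : ‖w‖ ≤ Real.exp ‖w‖ := by linarith [Real.add_one_le_exp ‖w‖]
  have h2 := norm_inner_le_norm (𝕜 := ℂ) (a - b) w
  calc Real.exp (r * ‖w‖) * ‖inner ℂ (a - b) w‖
      ≤ Real.exp (r * ‖w‖) * (‖a - b‖ * Real.exp ‖w‖) := by
        gcongr
        exact h2.trans (by gcongr)
    _ = ‖a - b‖ * Real.exp ((r + 1) * ‖w‖) := by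
        rw [add_mul, one_mul, Real.exp_add]; ring

namespace FockSpace

variable {n : ℕ} {p q : ℝ≥0∞}

theorem ext {f g : FockSpace n p} (h : ∀ w, f w = g w) : f = g :=
  Subtype.ext (funext h)

/-- The reproducing kernel `K_a` as an element of `Fᵖ`. -/
noncomputable def kernel (p : ℝ≥0∞) (a : Cn n) : FockSpace n p :=
  (Real.exp (‖a‖ ^ 2 / 2) : ℂ) • fockK p a

theorem kernel_apply (a w : Cn n) : kernel p a w = Complex.exp (inner ℂ a w) := by
  change (Real.exp (‖a‖ ^ 2 / 2) : ℂ) * (fockKernel a w / (Real.exp (‖a‖ ^ 2 / 2) : ℂ)) = _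
  rw [mul_div_cancel₀ _ (Complex.ofReal_ne_zero.2 (Real.exp_pos _).ne'), fockKernel_eq_exp_inner]

theorem fockK_eq_smul_kernel (a : Cn n) :
    fockK p a = (Real.exp (-(‖a‖ ^ 2 / 2)) : ℂ) • kernel p a := by
  rw [kernel, smul_smul, ← Complex.ofReal_mul, ← Real.exp_add, neg_add_cancel, Real.exp_zero,
    Complex.ofReal_one, one_smul]

section Growth

variable [Fact (1 ≤ p)]

theorem exists_forall_norm_le_of_growth (n : ℕ) (htop : p ≠ ∞) (B : ℝ) :
    ∃ G : ℝ, 0 ≤ G ∧ ∀ (A : ℝ) (f : FockSpace n p), 0 ≤ A →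
      (∀ w, ‖f w‖ ≤ A * Real.exp (B * ‖w‖)) → ‖f‖ ≤ A * G := by
  obtain ⟨G, hG, h⟩ := exists_norm_le_of_growth n p htop B
  refine ⟨G, hG, fun A f hA hf => ?_⟩
  obtain ⟨g, hg, hn⟩ := h A f hA f.differentiable hf
  rwa [ext hg] at hn

theorem continuous_kernel (htop : p ≠ ∞) : Continuous (kernel p : Cn n → FockSpace n p) := by
  refine continuous_iff_continuousAt.2 fun a => ?_
  obtain ⟨G, hG, h⟩ := exists_forall_norm_le_of_growth (p := p) n htop (‖a‖ + 1 + 1)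
  rw [ContinuousAt, tendsto_iff_norm_sub_tendsto_zero]
  have hz : Tendsto (fun b : Cn n => ‖b - a‖ * G) (𝓝 a) (𝓝 0) := by
    have : Continuous fun b : Cn n => ‖b - a‖ * G := by fun_prop
    exact this.tendsto' a 0 (by simp)
  refine squeeze_zero' (Eventually.of_forall fun b => norm_nonneg _) ?_ hz
  have hev : ∀ᶠ b : Cn n in 𝓝 a, ‖b‖ < ‖a‖ + 1 :=
    continuous_norm.continuousAt.eventually_lt continuousAt_const (by simp)
  filter_upwards [hev] with b hb
  refine h _ _ (norm_nonneg _) fun w => ?_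
  change ‖kernel p b w - kernel p a w‖ ≤ _
  rw [kernel_apply, kernel_apply]
  exact norm_exp_inner_sub_le hb.le (by linarith)

theorem continuous_fockK (htop : p ≠ ∞) : Continuous (fockK p : Cn n → FockSpace n p) := by
  have h : (fockK p : Cn n → FockSpace n p) =
      fun a => (Real.exp (-(‖a‖ ^ 2 / 2)) : ℂ) • kernel p a := funext fockK_eq_smul_kernel
  rw [h]
  have hc : Continuous fun a : Cn n => (Real.exp (-(‖a‖ ^ 2 / 2)) : ℂ) := by fun_prop
  exact hc.smul (continuous_kernel htop)

end Growth

section Evaluation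

variable [Fact (1 ≤ p)]

/-- The weighted evaluation functional `f ↦ f(w) e^{-|w|²/2}`. -/
noncomputable def evalWeighted (p : ℝ≥0∞) [Fact (1 ≤ p)] (w : Cn n) : FockSpace n p →L[ℂ] ℂ :=
  LinearMap.mkContinuousOfExistsBound
    { toFun := fun f => fockWeighted f w
      map_add' := fun f g => add_mul (f w) (g w) _
      map_smul' := fun c f => mul_assoc c (f w) _ }
    (by
      obtain ⟨C, -, h⟩ := exists_norm_fockWeighted_le n p
      exact ⟨C, fun f => h f w⟩)

@[simp]
theorem evalWeighted_apply (f : FockSpace n p) (w : Cn n) :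
    evalWeighted p w f = fockWeighted f w := rfl

/-- The evaluation functional `f ↦ f(w)`. -/
noncomputable def eval (p : ℝ≥0∞) [Fact (1 ≤ p)] (w : Cn n) : FockSpace n p →L[ℂ] ℂ :=
  (Real.exp (‖w‖ ^ 2 / 2) : ℂ) • evalWeighted p w

@[simp]
theorem eval_apply (f : FockSpace n p) (w : Cn n) : eval p w f = f w := by
  rw [apply_eq_fockWeighted_mul f w, mul_comm]
  rfl

/-- The difference of two evaluations is the pairing with k_b - k_a in the dual Fock space. The
hypothesis p > 1 makes the conjugate exponent finite, where z ↦ k_z is norm continuous. This is the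
source of compactness on balls. -/
theorem continuous_evalWeighted (hp : 1 < p) :
    Continuous (evalWeighted p : Cn n → FockSpace n p →L[ℂ] ℂ) := by
  have hpq := ENNReal.HolderConjugate.conjExponent (Fact.out : 1 ≤ p)
  set q := p.conjExponent
  have hq1 : Fact (1 ≤ q) := ⟨ENNReal.HolderConjugate.one_le q p⟩
  have hq : q ≠ ∞ := (ENNReal.HolderConjugate.lt_top_iff_one_lt q p).2 hp |>.ne
  refine continuous_iff_continuousAt.2 fun a => ?_
  rw [ContinuousAt, tendsto_iff_norm_sub_tendsto_zero]
  have hz : Tendsto (fun b : Cn n => (Real.pi ^ n)⁻¹ * ‖fockK q b - fockK q a‖) (𝓝 a) (𝓝 0) := by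
    have hc := continuous_fockK (n := n) hq
    have : Continuous fun b : Cn n => (Real.pi ^ n)⁻¹ * ‖fockK q b - fockK q a‖ := by fun_prop
    exact this.tendsto' a 0 (by simp)
  refine squeeze_zero (fun b => norm_nonneg _) (fun b => ?_) hz
  refine ContinuousLinearMap.opNorm_le_bound _ (by positivity) fun f => ?_
  have h := norm_fockInner_le f (fockK q b - fockK q a)
  have h2 : fockInner f (fockK q b - fockK q a : FockSpace n q) =
      fockWeighted f b - fockWeighted f a := by
    rw [← f.fockInner_normalizedKernel b, ← f.fockInner_normalizedKernel a, fockInner_eq,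
      fockInner_eq, fockInner_eq, ← mul_sub, ← integral_sub
        (f.integrable_mul_conj (memLp_fockNormalizedKernel q b))
        (f.integrable_mul_conj (memLp_fockNormalizedKernel q a))]
    congr 2
    funext w
    rw [fockWeighted_sub, map_sub, mul_sub]
    rfl
  rw [h2] at h
  rw [_root_.sub_apply, evalWeighted_apply, evalWeighted_apply]
  linarith

theorem berezinTransform_eq (T : FockSpace n p →L[ℂ] FockSpace n p) (z : Cn n) :
    berezinTransform T z = fockWeighted (T (fockK p z)) z :=
  fockInner_normalizedKernel _ _

end Evaluation

/-! ### From the diagonal to bands around it -/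

section OffDiagonal

variable [Fact (1 ≤ p)]

/-- The kernel K_a depends antiholomorphically on a, so conjugating t makes it a power series in t,
namely the exponential series of t⟨ζ₁, w⟩ times e^{⟨ζ₀, w⟩}. The bound x^k/k! ≤ e^x with x =
r‖ζ₁‖‖w‖ gives all coefficients one exponential type. Norm convergence lets T act termwise. -/
theorem exists_hasSum_kernel_line (htop : p ≠ ∞) (ζ₀ ζ₁ : Cn n) {r : ℝ} (hr : 0 < r) :
    ∃ (g : ℕ → FockSpace n p) (G : ℝ), 0 ≤ G ∧ (∀ k, ‖g k‖ ≤ G / r ^ k) ∧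
      ∀ t : ℂ, ‖t‖ < r → HasSum (fun k => t ^ k • g k) (kernel p (ζ₀ + conj t • ζ₁)) := by
  obtain ⟨G, hG, hgr⟩ := exists_norm_le_of_growth n p htop (r * ‖ζ₁‖ + ‖ζ₀‖)
  have hd : ∀ ζ : Cn n, Differentiable ℂ fun w : Cn n => inner ℂ ζ w :=
    fun ζ => (innerSL ℂ ζ).differentiable
  have hex : ∀ k : ℕ, ∃ h : FockSpace n p,
      (∀ w, h w = inner ℂ ζ₁ w ^ k / (k.factorial : ℂ) * Complex.exp (inner ℂ ζ₀ w)) ∧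
      ‖h‖ ≤ (r ^ k)⁻¹ * G := fun k => by
    refine hgr _ _ (by positivity) ?_ fun w => ?_
    · have h0 := hd ζ₀
      have h1 := hd ζ₁
      fun_prop
    · rw [norm_mul, norm_div, norm_pow, Complex.norm_natCast, Complex.norm_exp, add_mul,
        Real.exp_add, ← mul_assoc]
      have h1 : ‖inner ℂ ζ₁ w‖ ≤ ‖ζ₁‖ * ‖w‖ := norm_inner_le_norm ζ₁ w
      have h2 : (inner ℂ ζ₀ w).re ≤ ‖ζ₀‖ * ‖w‖ :=
        (Complex.re_le_norm _).trans (norm_inner_le_norm ζ₀ w)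
      have h3 := Real.pow_div_factorial_le_exp (r * ‖ζ₁‖ * ‖w‖) (by positivity) k
      gcongr
      rw [le_inv_mul_iff₀ (by positivity)]
      refine le_trans ?_ h3
      rw [mul_assoc, mul_pow r, mul_div_assoc]
      gcongr
  choose g hg hgn using hex
  refine ⟨g, G, hG, fun k => by rw [div_eq_inv_mul]; exact hgn k, fun t ht => ?_⟩
  have hs : Summable fun k => t ^ k • g k := by
    refine Summable.of_norm_bounded (g := fun k => (‖t‖ / r) ^ k * G)
      ((summable_geometric_of_lt_one (by positivity) ((div_lt_one hr).2 ht)).mul_right G)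
      fun k => ?_
    rw [norm_smul, norm_pow, div_pow, div_eq_mul_inv, mul_assoc]
    gcongr
    exact hgn k
  obtain ⟨h, hh⟩ := hs
  have : h = kernel p (ζ₀ + conj t • ζ₁) := by
    refine ext fun w => ?_
    have h1 := (eval p w).hasSum hh
    rw [eval_apply] at h1
    refine h1.unique ?_
    rw [kernel_apply, inner_add_left, inner_smul_left, Complex.conj_conj, Complex.exp_add, mul_comm]
    have h2 := (NormedSpace.expSeries_div_hasSum_exp (t * inner ℂ ζ₁ w)).mul_right
      (Complex.exp (inner ℂ ζ₀ w))
    rw [← Complex.exp_eq_exp_ℂ] at h2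
    refine h2.congr_fun ?_
    intro k
    simp only [map_smul, eval_apply, hg, smul_eq_mul]
    ring
  rwa [this] at hh

theorem differentiable_apply_kernel_line (htop : p ≠ ∞) (T : FockSpace n p →L[ℂ] FockSpace n p)
    (ζ₀ ζ₁ : Cn n) :
    Differentiable ℂ fun t : ℂ => T (kernel p (ζ₀ + conj t • ζ₁)) (ζ₀ + t • ζ₁) := by
  intro t₀
  set s : ℝ := ‖t₀‖ + 1 with hs
  have hs0 : 0 < s := by positivity
  -- Taking radius 2s makes the k-th term O(2^{-k}) on the disc of radius s.
  obtain ⟨g, G, hG, hgn, hsum⟩ := exists_hasSum_kernel_line (p := p) htop ζ₀ ζ₁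
    (r := 2 * s) (by positivity)
  obtain ⟨C, hC, hev⟩ := exists_norm_fockWeighted_le n p
  set U := Metric.ball (0 : ℂ) s
  have heq : Set.EqOn (fun t : ℂ => T (kernel p (ζ₀ + conj t • ζ₁)) (ζ₀ + t • ζ₁))
      (fun t => ∑' k, t ^ k * T (g k) (ζ₀ + t • ζ₁)) U := fun t ht => by
    have ht' : ‖t‖ < s := mem_ball_zero_iff.1 ht
    have h := ((eval p (ζ₀ + t • ζ₁)).comp T).hasSum (hsum t (by linarith))
    simp only [map_smul, ContinuousLinearMap.comp_apply, eval_apply,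
      smul_eq_mul] at h
    exact h.tsum_eq.symm
  set A : ℝ := Real.exp ((‖ζ₀‖ + s * ‖ζ₁‖) ^ 2 / 2)
  have hdiff : DifferentiableOn ℂ (fun t => ∑' k, t ^ k * T (g k) (ζ₀ + t • ζ₁)) U := by
    refine Complex.differentiableOn_tsum_of_summable_norm
      (u := fun k : ℕ => (1 / 2 : ℝ) ^ k * (C * (‖T‖ * G) * A))
      ((summable_geometric_of_lt_one (by norm_num) (by norm_num)).mul_right _)
      (fun k => ?_) Metric.isOpen_ball fun k t ht => ?_
    · have := (T (g k)).differentiable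
      fun_prop
    · have ht' : ‖t‖ < s := mem_ball_zero_iff.1 ht
      have h1 : ‖T (g k) (ζ₀ + t • ζ₁)‖ ≤ C * (‖T‖ * (G / (2 * s) ^ k)) * A := by
        rw [apply_eq_fockWeighted_mul (T (g k)), norm_mul, Complex.norm_real,
          Real.norm_of_nonneg (Real.exp_pos _).le]
        have h2 : ‖ζ₀ + t • ζ₁‖ ≤ ‖ζ₀‖ + s * ‖ζ₁‖ :=
          (norm_add_le _ _).trans (by rw [norm_smul]; gcongr)
        have h3 : ‖fockWeighted (T (g k)) (ζ₀ + t • ζ₁)‖ ≤ C * (‖T‖ * (G / (2 * s) ^ k)) :=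
          (hev _ _).trans (by
            gcongr
            exact (T.le_opNorm _).trans (by gcongr; exact hgn k))
        simp only [A]
        gcongr
      rw [norm_mul, norm_pow]
      calc ‖t‖ ^ k * ‖T (g k) (ζ₀ + t • ζ₁)‖
          ≤ s ^ k * (C * (‖T‖ * (G / (2 * s) ^ k)) * A) := by gcongr
        _ = (1 / 2 : ℝ) ^ k * (C * (‖T‖ * G) * A) := by
          rw [mul_pow, one_div, inv_pow]
          field_simp
  have hmem : U ∈ 𝓝 t₀ := Metric.isOpen_ball.mem_nhds (by simp [hs])
  exact (hdiff.congr heq).differentiableAt hmem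

/-- The factor e^{-⟨a,b⟩} is a holomorphic substitute for the Gaussian normalizations at a and b.
The discrepancy e^{|a-b|²/2} is 1 on the diagonal, at least 1 everywhere and bounded on bands. -/
theorem norm_apply_kernel_mul_exp (T : FockSpace n p →L[ℂ] FockSpace n p) (a b : Cn n) :
    ‖T (kernel p a) b * Complex.exp (-inner ℂ a b)‖ =
      ‖fockWeighted (T (fockK p a)) b‖ * Real.exp (‖a - b‖ ^ 2 / 2) := by
  have h := @norm_sub_sq ℂ _ _ _ _ a b
  rw [apply_eq_fockWeighted_mul (T (kernel p a)), kernel, map_smul]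
  change ‖((Real.exp (‖a‖ ^ 2 / 2) : ℂ) * (T (fockK p a)) b * _) * _ * _‖ = _
  rw [mul_assoc (Real.exp (‖a‖ ^ 2 / 2) : ℂ)]
  change ‖((Real.exp (‖a‖ ^ 2 / 2) : ℂ) * fockWeighted (T (fockK p a)) b) * _ * _‖ = _
  rw [norm_mul, norm_mul, norm_mul, Complex.norm_exp, Complex.norm_real, Complex.norm_real,
    Real.norm_of_nonneg (Real.exp_pos _).le, Real.norm_of_nonneg (Real.exp_pos _).le, mul_comm
    (Real.exp (‖a‖ ^ 2 / 2)), mul_assoc, mul_assoc, ← Real.exp_add, ← Real.exp_add, h]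
  simp only [Complex.neg_re, RCLike.re_to_complex]
  ring_nf

/-- If the Berezin transform vanishes at infinity, so does the kernel `⟨T k_z, k_w⟩` along every
band around the diagonal. -/
theorem exists_forall_norm_offDiagonal_le (htop : p ≠ ∞) (T : FockSpace n p →L[ℂ] FockSpace n p)
    (hB : Tendsto (berezinTransform T) (Bornology.cobounded (Cn n)) (𝓝 0)) (R : ℝ) {η : ℝ}
    (hη : 0 < η) :
    ∃ ρ : ℝ, ∀ z w : Cn n, ‖z - w‖ ≤ R → ρ ≤ ‖w‖ → ‖fockWeighted (T (fockK p z)) w‖ ≤ η := by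
  -- The filter of pairs (z, w) with |w| → ∞ inside the band |z - w| ≤ R.
  set l : Filter (Cn n × Cn n) := comap (fun x => ‖x.2‖) atTop ⊓ 𝓟 {x | ‖x.1 - x.2‖ ≤ R} with hl
  -- With midpoint ζ₀ and direction ζ₁ = i(z - w)/2, the points ζ₀ + t̄ζ₁ and ζ₀ + tζ₁ coincide for
  -- real t and equal z and w at t = i.
  set ζ₀ : Cn n × Cn n → Cn n := fun x => (1 / 2 : ℂ) • (x.1 + x.2)
  set ζ₁ : Cn n × Cn n → Cn n := fun x => (Complex.I / 2) • (x.1 - x.2)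
  set φ : Cn n × Cn n → ℂ → ℂ := fun x t =>
    T (kernel p (ζ₀ x + conj t • ζ₁ x)) (ζ₀ x + t • ζ₁ x) *
      Complex.exp (-inner ℂ (ζ₀ x + conj t • ζ₁ x) (ζ₀ x + t • ζ₁ x)) with hφ
  have hζ₁ : ∀ x, ‖ζ₁ x‖ = ‖x.1 - x.2‖ / 2 := fun x => by
    simp [ζ₁, norm_smul]; ring
  have hnorm : ∀ x t, ‖φ x t‖ = ‖fockWeighted (T (fockK p (ζ₀ x + conj t • ζ₁ x)))
      (ζ₀ x + t • ζ₁ x)‖ * Real.exp (‖(conj t - t) • ζ₁ x‖ ^ 2 / 2) := fun x t => by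
    rw [hφ, norm_apply_kernel_mul_exp, add_sub_add_left_eq_sub, ← sub_smul]
  obtain ⟨C, hC, hev⟩ := exists_norm_fockWeighted_le n p
  -- For |t| ≤ 2 the two points differ by (t̄ - t)ζ₁, of norm at most 4 · R/2.
  set M : ℝ := C * (‖T‖ * ‖fockK p (0 : Cn n)‖) * Real.exp ((4 * (R / 2)) ^ 2 / 2) with hM
  have hI : Tendsto (fun x => φ x Complex.I) l (𝓝 0) := by
    refine tendsto_apply_I_of_tendsto_real (M := M) (fun x => ?_) ?_ fun t => ?_
    · refine (differentiable_apply_kernel_line htop T (ζ₀ x) (ζ₁ x)).mul ?_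
      have hin : (fun t : ℂ => inner ℂ (ζ₀ x + conj t • ζ₁ x) (ζ₀ x + t • ζ₁ x)) = fun t : ℂ =>
          inner ℂ (ζ₀ x) (ζ₀ x) + t * inner ℂ (ζ₀ x) (ζ₁ x) + (t * inner ℂ (ζ₁ x) (ζ₀ x) +
            t * (t * inner ℂ (ζ₁ x) (ζ₁ x))) := by
        funext t
        simp only [inner_add_left, inner_add_right, inner_smul_left, inner_smul_right,
          Complex.conj_conj]
        ring
      have hd : Differentiable ℂ
          fun t : ℂ => inner ℂ (ζ₀ x + conj t • ζ₁ x) (ζ₀ x + t • ζ₁ x) := by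
        rw [hin]; fun_prop
      exact hd.neg.cexp
    · refine eventually_inf_principal.2 (Eventually.of_forall fun x hx t ht => ?_)
      have hx' : ‖x.1 - x.2‖ ≤ R := hx
      rw [hnorm, hM]
      have h1 : ‖fockWeighted (T (fockK p (ζ₀ x + conj t • ζ₁ x))) (ζ₀ x + t • ζ₁ x)‖ ≤
          C * (‖T‖ * ‖fockK p (0 : Cn n)‖) :=
        (hev _ _).trans (by
          gcongr
          exact (T.le_opNorm _).trans_eq (by rw [norm_fockK]))
      have h2 : ‖(conj t - t) • ζ₁ x‖ ≤ 4 * (R / 2) := by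
        rw [norm_smul, hζ₁]
        have h3 : ‖conj t - t‖ ≤ 4 := (norm_sub_le _ _).trans (by
          rw [RCLike.norm_conj]; linarith)
        gcongr
      gcongr
    -- For real t the modulus is that of the Berezin transform at ζ₀ + tζ₁, which stays within
    -- bounded distance of w and so tends to infinity.
    · rw [tendsto_zero_iff_norm_tendsto_zero]
      have hline : Tendsto (fun x => ζ₀ x + (t : ℂ) • ζ₁ x) l (Bornology.cobounded (Cn n)) := by
        rw [← tendsto_norm_atTop_iff_cobounded]
        have h1 : Tendsto (fun x : Cn n × Cn n => ‖x.2‖ - (R / 2 + |t| * (R / 2))) l atTop :=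
          tendsto_atTop_add_const_right _ _ (tendsto_comap.mono_left inf_le_left)
        refine tendsto_atTop_mono' _ (eventually_inf_principal.2
          (Eventually.of_forall fun x hx => ?_)) h1
        have hx' : ‖x.1 - x.2‖ ≤ R := hx
        have h2 : x.2 = (ζ₀ x + (t : ℂ) • ζ₁ x) + (-((1 / 2 : ℂ) • (x.1 - x.2)) +
            -((t : ℂ) • ζ₁ x)) := by
          simp only [ζ₀]
          module
        have h3 : ‖x.2‖ ≤ ‖ζ₀ x + (t : ℂ) • ζ₁ x‖ + (‖x.1 - x.2‖ / 2 +
            |t| * (‖x.1 - x.2‖ / 2)) := by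
          conv_lhs => rw [h2]
          refine (norm_add_le _ _).trans ?_
          gcongr
          refine (norm_add_le _ _).trans ?_
          rw [norm_neg, norm_neg, norm_smul, norm_smul, hζ₁, Complex.norm_real, Real.norm_eq_abs]
          norm_num
          linarith
        have h4 : |t| * (‖x.1 - x.2‖ / 2) ≤ |t| * (R / 2) := by gcongr
        linarith
      have := (hB.comp hline).norm
      rw [norm_zero] at this
      refine this.congr fun x => ?_
      rw [hnorm, Complex.conj_ofReal, Function.comp_apply, berezinTransform_eq]
      simp
  have hI2 := (tendsto_zero_iff_norm_tendsto_zero.1 hI).eventually (eventually_le_nhds hη)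
  rw [hl, eventually_inf_principal, (atTop_basis.comap _).eventually_iff] at hI2
  obtain ⟨ρ, -, hρ⟩ := hI2
  refine ⟨ρ, fun z w hzw hw => ?_⟩
  have h := @hρ (z, w) hw hzw
  have e1 : ζ₀ (z, w) + conj Complex.I • ζ₁ (z, w) = z := by
    simp only [ζ₀, ζ₁, smul_smul, Complex.conj_I]
    rw [neg_mul, ← mul_div_assoc, Complex.I_mul_I]
    module
  have e2 : ζ₀ (z, w) + Complex.I • ζ₁ (z, w) = w := by
    simp only [ζ₀, ζ₁, smul_smul]
    rw [← mul_div_assoc, Complex.I_mul_I]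
    module
  rw [hnorm, e1, e2] at h
  refine le_trans ?_ h
  exact le_mul_of_one_le_right (norm_nonneg _) (Real.one_le_exp (by positivity))

end OffDiagonal

end FockSpace

/-! ### Young's inequality and tails of integrals -/

section Young

variable {E : Type*} [NormedAddCommGroup E] [MeasurableSpace E] [BorelSpace E]
  [SecondCountableTopology E] {μ : Measure E} [SFinite μ] [μ.IsAddLeftInvariant] [μ.IsNegInvariant]

/-- Young's inequality `‖g ⋆ H‖_p ≤ ‖H‖₁ ‖g‖_p` for nonnegative functions. -/
theorem lintegral_lconvolution_rpow_le {r : ℝ} (hr : 1 < r) {g H : E → ℝ≥0∞} (hg : Measurable g)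
    (hH : Measurable H) :
    ∫⁻ w, (∫⁻ z, g z * H (w - z) ∂μ) ^ r ∂μ ≤ (∫⁻ u, H u ∂μ) ^ r * ∫⁻ z, g z ^ r ∂μ := by
  have hr0 : 0 < r := zero_lt_one.trans hr
  have hrs := Real.HolderConjugate.conjExponent hr
  set s := Real.conjExponent r
  set I := ∫⁻ u, H u ∂μ
  have hinner : ∀ w, (∫⁻ z, g z * H (w - z) ∂μ) ^ r ≤
      (∫⁻ z, g z ^ r * H (w - z) ∂μ) * I ^ (r - 1) := fun w => by
    have hHw : Measurable fun z => H (w - z) := by fun_prop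
    -- Hölder with H split as H^{1/r} H^{1/s}, so that only the first part stays with g.
    have h := ENNReal.lintegral_mul_le_Lp_mul_Lq μ hrs
      (f := fun z => g z * H (w - z) ^ (1 / r)) (g := fun z => H (w - z) ^ (1 / s))
      (by fun_prop) (by fun_prop)
    have e1 : ∀ z, ((fun z => g z * H (w - z) ^ (1 / r)) * fun z => H (w - z) ^ (1 / s)) z =
        g z * H (w - z) := fun z => by
      rw [Pi.mul_apply, mul_assoc, ← ENNReal.rpow_add_of_nonneg _ _ (by positivity)
        (one_div_nonneg.2 hrs.symm.nonneg), one_div, one_div, hrs.inv_add_inv_eq_one,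
        ENNReal.rpow_one]
    have e2 : ∀ z, (g z * H (w - z) ^ (1 / r)) ^ r = g z ^ r * H (w - z) := fun z => by
      rw [ENNReal.mul_rpow_of_nonneg _ _ hr0.le, ← ENNReal.rpow_mul, one_div_mul_cancel hr0.ne',
        ENNReal.rpow_one]
    have e3 : ∀ z, (H (w - z) ^ (1 / s)) ^ s = H (w - z) := fun z => by
      rw [← ENNReal.rpow_mul, one_div_mul_cancel hrs.symm.ne_zero, ENNReal.rpow_one]
    simp only [e1, e2, e3] at h
    rw [lintegral_sub_left_eq_self H w] at h
    calc (∫⁻ z, g z * H (w - z) ∂μ) ^ r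
        ≤ ((∫⁻ z, g z ^ r * H (w - z) ∂μ) ^ (1 / r) * I ^ (1 / s)) ^ r := by gcongr
      _ = _ := by
        rw [ENNReal.mul_rpow_of_nonneg _ _ hr0.le, ← ENNReal.rpow_mul, ← ENNReal.rpow_mul,
          one_div_mul_cancel hr0.ne', ENNReal.rpow_one]
        congr 2
        rw [one_div_mul_eq_div]
        exact hrs.div_conj_eq_sub_one
  calc ∫⁻ w, (∫⁻ z, g z * H (w - z) ∂μ) ^ r ∂μ
      ≤ ∫⁻ w, (∫⁻ z, g z ^ r * H (w - z) ∂μ) * I ^ (r - 1) ∂μ := lintegral_mono hinner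
    _ = (∫⁻ w, ∫⁻ z, g z ^ r * H (w - z) ∂μ ∂μ) * I ^ (r - 1) := by
        refine lintegral_mul_const _ (Measurable.lintegral_prod_right ?_)
        fun_prop
    _ = (∫⁻ z, ∫⁻ w, g z ^ r * H (w - z) ∂μ ∂μ) * I ^ (r - 1) := by
        rw [lintegral_lintegral_swap]
        exact Measurable.aemeasurable (by fun_prop)
    _ = (∫⁻ z, g z ^ r * I ∂μ) * I ^ (r - 1) := by
        congr 2
        funext z
        rw [lintegral_const_mul _ (by fun_prop), lintegral_sub_right_eq_self H z]
    _ = I ^ r * ∫⁻ z, g z ^ r ∂μ := by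
        rw [lintegral_mul_const _ (by fun_prop), mul_assoc, mul_comm]
        congr 1
        nth_rewrite 1 [← ENNReal.rpow_one I]
        rw [← ENNReal.rpow_add_of_nonneg _ _ zero_le_one (by linarith)]
        congr 1
        ring

theorem eLpNorm_lconvolution_le {p : ℝ≥0∞} (hp : 1 < p) (htop : p ≠ ∞) {g H : E → ℝ≥0∞}
    (hg : Measurable g) (hH : Measurable H) :
    eLpNorm (fun w => ∫⁻ z, g z * H (w - z) ∂μ) p μ ≤ (∫⁻ u, H u ∂μ) * eLpNorm g p μ := by
  have h0 : p ≠ 0 := (zero_lt_one.trans hp).ne'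
  have hr : 1 < p.toReal := by
    rw [← ENNReal.toReal_one]
    exact (ENNReal.toReal_lt_toReal ENNReal.one_ne_top htop).2 hp
  have hr0 : 0 < p.toReal := zero_lt_one.trans hr
  rw [eLpNorm_eq_lintegral_rpow_enorm_toReal h0 htop, eLpNorm_eq_lintegral_rpow_enorm_toReal h0 htop]
  simp only [enorm_eq_self]
  calc _ ≤ ((∫⁻ u, H u ∂μ) ^ p.toReal * ∫⁻ z, g z ^ p.toReal ∂μ) ^ (1 / p.toReal) := by
        gcongr
        exact lintegral_lconvolution_rpow_le hr hg hH
    _ = _ := by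
        rw [ENNReal.mul_rpow_of_nonneg _ _ (by positivity), ← ENNReal.rpow_mul,
          mul_one_div_cancel hr0.ne', ENNReal.rpow_one]

end Young

section Tails

/-- The mass of an integrable function outside large balls is small. -/
theorem tendsto_setLIntegral_compl_closedBall {E : Type*} [NormedAddCommGroup E]
    [MeasurableSpace E] [BorelSpace E] {μ : Measure E} {f : E → ℝ≥0∞} (hf : Measurable f)
    (hfi : ∫⁻ x, f x ∂μ ≠ ∞) :
    Tendsto (fun m : ℕ => ∫⁻ x in (Metric.closedBall 0 (m : ℝ))ᶜ, f x ∂μ) atTop (𝓝 0) := by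
  have h : ∀ m : ℕ, ∫⁻ x in (Metric.closedBall 0 (m : ℝ))ᶜ, f x ∂μ =
      ∫⁻ x, (Metric.closedBall 0 (m : ℝ))ᶜ.indicator f x ∂μ := fun m =>
    (lintegral_indicator Metric.isClosed_closedBall.measurableSet.compl f).symm
  simp only [h]
  rw [← lintegral_zero (μ := μ) (α := E)]
  refine tendsto_lintegral_of_dominated_convergence f
    (fun m => hf.indicator Metric.isClosed_closedBall.measurableSet.compl)
    (fun m => Eventually.of_forall fun x => Set.indicator_le_self _ _ _) hfi
    (Eventually.of_forall fun x => ?_)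
  refine tendsto_const_nhds.congr' ?_
  obtain ⟨N, hN⟩ := exists_nat_ge ‖x‖
  filter_upwards [eventually_ge_atTop N] with m hm
  rw [Set.indicator_of_notMem]
  simpa using hN.trans (Nat.cast_le.2 hm)

end Tails

theorem eLpNorm_indicator_enorm {n : ℕ} {p : ℝ≥0∞} (hp : 1 < p) (htop : p ≠ ∞)
    {Q : Set (Cn n)} (hQm : MeasurableSet Q) (g : Cn n → ℂ) :
    eLpNorm (Q.indicator fun z => ‖g z‖ₑ) p volume =
      (∫⁻ z in Q, ‖g z‖ₑ ^ p.toReal) ^ (1 / p.toReal) := by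
  have h0 : p ≠ 0 := (zero_lt_one.trans hp).ne'
  rw [eLpNorm_indicator_eq_eLpNorm_restrict hQm, eLpNorm_eq_lintegral_rpow_enorm_toReal h0 htop]
  simp only [enorm_eq_self]

/-! ### Truncated reproducing formula -/

namespace FockSpace

variable {n : ℕ} {p : ℝ≥0∞} [Fact (1 ≤ p)]

/-- The integral over `Q` in the reproducing formula `f = π⁻ⁿ ∫ ⟨f, k_z⟩ k_z dv(z)`. -/
noncomputable def partialProj (Q : Set (Cn n)) (f : FockSpace n p) : FockSpace n p :=
  ((Real.pi ^ n)⁻¹ : ℂ) • ∫ z in Q, fockWeighted f z • fockK p z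

theorem integrableOn_smul_fockK (htop : p ≠ ∞) {Q : Set (Cn n)} (hQ : Bornology.IsBounded Q)
    (f : FockSpace n p) : IntegrableOn (fun z => fockWeighted f z • fockK p z) Q := by
  obtain ⟨R, hR⟩ := hQ.subset_closedBall (0 : Cn n)
  refine IntegrableOn.mono_set ?_ hR
  exact (f.continuous_weighted.smul (continuous_fockK htop)).continuousOn.integrableOn_compact
    (isCompact_closedBall _ _)

theorem clm_partialProj (htop : p ≠ ∞) {Q : Set (Cn n)} (hQ : Bornology.IsBounded Q)
    (f : FockSpace n p) (L : FockSpace n p →L[ℂ] ℂ) :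
    L (partialProj Q f) =
      ((Real.pi ^ n)⁻¹ : ℂ) * ∫ z in Q, fockWeighted f z * L (fockK p z) := by
  rw [partialProj, map_smul, ← L.integral_comp_comm (integrableOn_smul_fockK htop hQ f), smul_eq_mul]
  simp only [map_smul, smul_eq_mul]

theorem enorm_inv_pi_pow_le_one (n : ℕ) : ‖((Real.pi ^ n)⁻¹ : ℂ)‖ₑ ≤ 1 := by
  rw [← ofReal_norm, ← Complex.ofReal_pow, ← Complex.ofReal_inv, Complex.norm_real,
    Real.norm_of_nonneg (by positivity)]
  refine ENNReal.ofReal_le_one.2 (inv_le_one_of_one_le₀ (one_le_pow₀ ?_))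
  linarith [Real.pi_gt_three]

theorem enorm_inv_pi_pow_mul_setIntegral_le (Q : Set (Cn n)) (f g : Cn n → ℂ) :
    ‖((Real.pi ^ n)⁻¹ : ℂ) * ∫ z in Q, f z * g z‖ₑ ≤ ∫⁻ z in Q, ‖f z‖ₑ * ‖g z‖ₑ := by
  rw [enorm_mul]
  refine (mul_le_of_le_one_left' (enorm_inv_pi_pow_le_one n)).trans ?_
  refine (enorm_integral_le_lintegral_enorm _).trans_eq ?_
  simp only [enorm_mul]

/-- The kernel estimate for `U P_Q`, where `P_Q` is `partialProj Q`. -/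
theorem enorm_apply_partialProj_le (htop : p ≠ ∞) (U : FockSpace n p →L[ℂ] FockSpace n p)
    {Q : Set (Cn n)} (hQ : Bornology.IsBounded Q) (f : FockSpace n p) (w : Cn n) :
    ‖fockWeighted (U (partialProj Q f)) w‖ₑ ≤
      ∫⁻ z in Q, ‖fockWeighted f z‖ₑ * ‖fockWeighted (U (fockK p z)) w‖ₑ := by
  have h := clm_partialProj htop hQ f ((evalWeighted p w).comp U)
  simp only [ContinuousLinearMap.comp_apply, evalWeighted_apply] at h
  rw [h]
  exact enorm_inv_pi_pow_mul_setIntegral_le _ _ _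

/-- The reproducing formula with the integral over a bounded set removed. -/
theorem fockWeighted_sub_partialProj (htop : p ≠ ∞) {Q : Set (Cn n)}
    (hQ : Bornology.IsBounded Q) (hQm : MeasurableSet Q) (f : FockSpace n p) (w : Cn n) :
    fockWeighted (f - partialProj Q f : FockSpace n p) w =
      ((Real.pi ^ n)⁻¹ : ℂ) * ∫ z in Qᶜ, fockWeighted f z * fockWeighted (fockK p z) w := by
  have hpq := ENNReal.HolderConjugate.conjExponent (Fact.out : 1 ≤ p)
  -- Hermitian symmetry of ⟨k_z, k_w⟩ turns the reproducing pairing into a superposition of kernels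
  -- evaluated at w.
  have hsymm : ∀ z, conj (fockWeighted (fockNormalizedKernel w) z) =
      fockWeighted (fockK p z) w := fun z => by
    change _ = fockWeighted (fockNormalizedKernel z) w
    have e : ∀ x : ℝ, (Real.exp (-x / 2) : ℂ) = (Real.exp (x / 2) : ℂ)⁻¹ := fun x => by
      rw [neg_div, Real.exp_neg, Complex.ofReal_inv]
    simp only [fockWeighted, fockNormalizedKernel, fockKernel_eq_exp_inner, map_mul, map_div₀,
      Complex.conj_ofReal, ← Complex.exp_conj, inner_conj_symm, e, map_inv₀]
    ring
  have hi := f.integrable_mul_conj (memLp_fockNormalizedKernel p.conjExponent w)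
  simp only [hsymm] at hi
  have h1 := f.fockInner_normalizedKernel w
  rw [fockInner_eq] at h1
  simp only [hsymm] at h1
  have h2 := clm_partialProj htop hQ f (evalWeighted p w)
  simp only [evalWeighted_apply] at h2
  rw [fockWeighted_sub, h2, ← h1, ← integral_add_compl hQm hi]
  push_cast
  ring

/-- The total mass of the Gaussian dominating the reproducing kernel. -/
noncomputable def gaussianMass (n : ℕ) : ℝ≥0∞ :=
  ∫⁻ u : Cn n, ENNReal.ofReal (Real.exp (-‖u‖ ^ 2 / 2))

theorem gaussianMass_ne_top (n : ℕ) : gaussianMass n ≠ ∞ := by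
  have h : Integrable fun u : Cn n => Real.exp (-‖u‖ ^ 2 / 2) := by
    have := memLp_exp_linear_sub_sq n (p := 1) one_ne_zero ENNReal.one_ne_top 0
    simpa using memLp_one_iff_integrable.1 this
  have h2 := h.lintegral_lt_top
  exact h2.ne

theorem ofReal_norm_le_of_lconvolution (hp : 1 < p) (htop : p ≠ ∞) {g H : Cn n → ℝ≥0∞}
    (hg : Measurable g) (hH : Measurable H) (f : FockSpace n p)
    (h : ∀ w, ‖fockWeighted f w‖ₑ ≤ ∫⁻ z, g z * H (w - z)) :
    ENNReal.ofReal ‖f‖ ≤ (∫⁻ u, H u) * eLpNorm g p volume := by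
  rw [← eLpNorm_eq]
  refine le_trans (eLpNorm_mono_enorm fun w => ?_) (eLpNorm_lconvolution_le hp htop hg hH)
  rw [enorm_eq_self]
  exact h w

/-- Since |⟨k_z, k_w⟩| = e^{-|w-z|²/2} is a convolution kernel, Young's inequality bounds h by the
mass of f on Q, uniformly in Q. The function h is left general to cover both P_Q f and, with the
complement of Q, the remainder f - P_Q f. -/
theorem ofReal_norm_le_gaussianMass_mul (hp : 1 < p) (htop : p ≠ ∞) {Q : Set (Cn n)}
    (hQm : MeasurableSet Q) (f h : FockSpace n p)
    (hh : ∀ w, fockWeighted h w =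
      ((Real.pi ^ n)⁻¹ : ℂ) * ∫ z in Q, fockWeighted f z * fockWeighted (fockK p z) w) :
    ENNReal.ofReal ‖h‖ ≤
      gaussianMass n * eLpNorm (Q.indicator fun z => ‖fockWeighted f z‖ₑ) p volume := by
  have hfm : Measurable fun z => ‖fockWeighted f z‖ₑ := f.continuous_weighted.measurable.enorm
  refine ofReal_norm_le_of_lconvolution hp htop (hfm.indicator hQm) (by fun_prop) h fun w => ?_
  rw [hh]
  refine (enorm_inv_pi_pow_mul_setIntegral_le _ _ _).trans_eq ?_
  rw [← lintegral_indicator hQm]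
  have hk : ∀ z, ‖fockWeighted (fockK p z) w‖ₑ =
      ENNReal.ofReal (Real.exp (-‖w - z‖ ^ 2 / 2)) := fun z => by
    rw [← norm_fockWeighted_normalizedKernel, ofReal_norm]
    rfl
  simp only [hk]
  exact lintegral_congr fun z => Set.indicator_mul_left Q _ _

theorem ofReal_norm_partialProj_le (hp : 1 < p) (htop : p ≠ ∞) {Q : Set (Cn n)}
    (hQ : Bornology.IsBounded Q) (hQm : MeasurableSet Q) (f : FockSpace n p) :
    ENNReal.ofReal ‖partialProj Q f‖ ≤
      gaussianMass n * eLpNorm (Q.indicator fun z => ‖fockWeighted f z‖ₑ) p volume :=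
  ofReal_norm_le_gaussianMass_mul hp htop hQm f _ fun w =>
    clm_partialProj htop hQ f (evalWeighted p w)

theorem lintegral_enorm_rpow_eq (hp : 1 < p) (htop : p ≠ ∞) (f : FockSpace n p) :
    ∫⁻ z, ‖fockWeighted f z‖ₑ ^ p.toReal = ENNReal.ofReal ‖f‖ ^ p.toReal := by
  have h0 : p ≠ 0 := (zero_lt_one.trans hp).ne'
  rw [← eLpNorm_eq, eLpNorm_eq_lintegral_rpow_enorm_toReal h0 htop, ← ENNReal.rpow_mul,
    one_div_mul_cancel (ENNReal.toReal_pos h0 htop).ne', ENNReal.rpow_one]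

/-- The remainder is controlled by the L^p tail of f. This is the reproducing formula as a norm
limit, through which bounded operators can be passed. -/
theorem tendsto_partialProj_closedBall (hp : 1 < p) (htop : p ≠ ∞) (f : FockSpace n p) :
    Tendsto (fun m : ℕ => partialProj (Metric.closedBall 0 (m : ℝ)) f) atTop (𝓝 f) := by
  have h0 : p ≠ 0 := (zero_lt_one.trans hp).ne'
  have hr : 0 < p.toReal := ENNReal.toReal_pos h0 htop
  have hB : ∀ m : ℕ, MeasurableSet (Metric.closedBall (0 : Cn n) (m : ℝ)) :=
    fun m => Metric.isClosed_closedBall.measurableSet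
  rw [tendsto_iff_norm_sub_tendsto_zero]
  have hfm : Measurable fun z => ‖fockWeighted f z‖ₑ := f.continuous_weighted.measurable.enorm
  have ht := tendsto_setLIntegral_compl_closedBall (μ := (volume : Measure (Cn n)))
    (hfm.pow_const p.toReal) (by
      rw [lintegral_enorm_rpow_eq hp htop]
      exact ENNReal.rpow_ne_top_of_nonneg hr.le ENNReal.ofReal_ne_top)
  have ht2 : Tendsto (fun m : ℕ => gaussianMass n *
      (∫⁻ z in (Metric.closedBall 0 (m : ℝ))ᶜ, ‖fockWeighted f z‖ₑ ^ p.toReal) ^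
        (1 / p.toReal)) atTop (𝓝 0) := by
    have h1 := (ENNReal.continuous_rpow_const (y := 1 / p.toReal)).tendsto 0 |>.comp ht
    rw [ENNReal.zero_rpow_of_pos (by positivity)] at h1
    have h2 := ENNReal.Tendsto.const_mul h1 (Or.inr (gaussianMass_ne_top n))
    rwa [mul_zero] at h2
  have hle : ∀ m : ℕ, ENNReal.ofReal ‖partialProj (Metric.closedBall 0 (m : ℝ)) f - f‖ ≤
      gaussianMass n * (∫⁻ z in (Metric.closedBall 0 (m : ℝ))ᶜ, ‖fockWeighted f z‖ₑ ^ p.toReal) ^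
        (1 / p.toReal) := fun m => by
    rw [norm_sub_rev, ← eLpNorm_indicator_enorm hp htop (hB m).compl]
    exact ofReal_norm_le_gaussianMass_mul hp htop (hB m).compl f _
      (fockWeighted_sub_partialProj htop Metric.isBounded_closedBall (hB m) f)
  have h3 := tendsto_of_tendsto_of_tendsto_of_le_of_le tendsto_const_nhds ht2
    (fun m => zero_le) hle
  have h4 := (ENNReal.tendsto_toReal ENNReal.zero_ne_top).comp h3
  simpa [Function.comp_def, ENNReal.toReal_ofReal] using h4

/-- The kernel estimate for `S (1 - P_Q)`, where `P_Q` is `partialProj Q`. -/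
theorem enorm_apply_sub_partialProj_le (hp : 1 < p) (htop : p ≠ ∞)
    (S : FockSpace n p →L[ℂ] FockSpace n p) {Q : Set (Cn n)} (hQ : Bornology.IsBounded Q)
    (hQm : MeasurableSet Q) (f : FockSpace n p) (w : Cn n) :
    ‖fockWeighted (S (f - partialProj Q f)) w‖ₑ ≤
      ∫⁻ z in Qᶜ, ‖fockWeighted f z‖ₑ * ‖fockWeighted (S (fockK p z)) w‖ₑ := by
  -- The complement of Q is unbounded, so the estimate is first proved on large balls with Q removed
  -- and then passed to the limit.
  have ht : Tendsto (fun m : ℕ => ‖(evalWeighted p w).comp S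
      (partialProj (Metric.closedBall 0 (m : ℝ)) f - partialProj Q f)‖ₑ) atTop
      (𝓝 ‖(evalWeighted p w).comp S (f - partialProj Q f)‖ₑ) :=
    (continuous_enorm.comp ((evalWeighted p w).comp S).continuous).continuousAt.tendsto.comp
      ((tendsto_partialProj_closedBall hp htop f).sub_const _)
  refine le_of_tendsto ht ?_
  obtain ⟨R, hR⟩ := hQ.subset_closedBall (0 : Cn n)
  obtain ⟨N, hN⟩ := exists_nat_ge R
  filter_upwards [eventually_ge_atTop N] with m hm
  have hsub : Q ⊆ Metric.closedBall 0 (m : ℝ) :=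
    hR.trans (Metric.closedBall_subset_closedBall (hN.trans (Nat.cast_le.2 hm)))
  have hdiff : partialProj (Metric.closedBall 0 (m : ℝ)) f - partialProj Q f =
      partialProj (Metric.closedBall 0 (m : ℝ) \ Q) f := by
    rw [partialProj, partialProj, partialProj, ← smul_sub, setIntegral_sdiff hQm
      (integrableOn_smul_fockK htop Metric.isBounded_closedBall f) hsub]
  rw [hdiff]
  refine (enorm_apply_partialProj_le htop S
    (Metric.isBounded_closedBall.subset Set.sdiff_subset) f w).trans ?_
  exact lintegral_mono_set fun z hz => hz.2

end FockSpace

/-! ### Decomposition into cubes with bounded overlap -/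

section Cubes

/-- The index of the cube with side `d` containing a point of `ℂⁿ`. -/
noncomputable def cubeIndex {n : ℕ} (d : ℝ) (w : Cn n) : Fin n → ℤ × ℤ :=
  fun i => (⌊(w i).re / d⌋, ⌊(w i).im / d⌋)

/-- The indices of the cubes touching a given one. -/
noncomputable def cubeNeighbors {n : ℕ} (j : Fin n → ℤ × ℤ) : Finset (Fin n → ℤ × ℤ) :=
  Fintype.piFinset fun i => Finset.Icc ((j i).1 - 1) ((j i).1 + 1) ×ˢ
    Finset.Icc ((j i).2 - 1) ((j i).2 + 1)

theorem mem_cubeNeighbors {n : ℕ} {i j : Fin n → ℤ × ℤ} :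
    i ∈ cubeNeighbors j ↔ ∀ k, |(i k).1 - (j k).1| ≤ 1 ∧ |(i k).2 - (j k).2| ≤ 1 := by
  simp only [cubeNeighbors, Fintype.mem_piFinset, Finset.mem_product, Finset.mem_Icc, abs_le]
  refine forall_congr' fun k => ?_
  constructor <;> intro h <;> omega

theorem mem_cubeNeighbors_comm {n : ℕ} {i j : Fin n → ℤ × ℤ} :
    i ∈ cubeNeighbors j ↔ j ∈ cubeNeighbors i := by
  simp only [mem_cubeNeighbors]
  refine forall_congr' fun k => ?_
  rw [abs_sub_comm, abs_sub_comm (j k).2]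

theorem card_cubeNeighbors {n : ℕ} (j : Fin n → ℤ × ℤ) : (cubeNeighbors j).card = 9 ^ n := by
  have h : ∀ a : ℤ, (Finset.Icc (a - 1) (a + 1)).card = 3 := fun a => by
    rw [Int.card_Icc]; omega
  simp [cubeNeighbors, Fintype.card_piFinset, Finset.card_product, h]

theorem measurable_cubeIndex (n : ℕ) (d : ℝ) : Measurable (cubeIndex (n := n) d) := by
  refine measurable_pi_lambda _ fun i => ?_
  have h : Measurable fun w : Cn n => w i := by fun_prop
  exact (Int.measurable_floor.comp ((Complex.measurable_re.comp h).div_const d)).prodMk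
    (Int.measurable_floor.comp ((Complex.measurable_im.comp h).div_const d))

theorem measurable_apply_cubeIndex {n : ℕ} (d : ℝ) {F : (Fin n → ℤ × ℤ) → Cn n → ℝ≥0∞}
    (hF : ∀ j, Measurable (F j)) : Measurable fun w => F (cubeIndex d w) w := by
  have h : Measurable (Function.uncurry fun (w : Cn n) (j : Fin n → ℤ × ℤ) => F j w) :=
    measurable_from_prod_countable_left hF
  exact h.comp (measurable_id.prodMk (measurable_cubeIndex n d))

theorem abs_sub_le_of_abs_floor_sub_le {d x y : ℝ} (hd : 0 < d)
    (h : |⌊x / d⌋ - ⌊y / d⌋| ≤ 1) : |x - y| ≤ 2 * d := by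
  have h1 := Int.floor_le (x / d)
  have h2 := Int.lt_floor_add_one (x / d)
  have h3 := Int.floor_le (y / d)
  have h4 := Int.lt_floor_add_one (y / d)
  have h5 : |(⌊x / d⌋ : ℝ) - ⌊y / d⌋| ≤ 1 := by exact_mod_cast h
  rw [abs_le] at h5
  have h6 : |x / d - y / d| ≤ 2 := by
    rw [abs_le]; constructor <;> linarith
  rwa [← sub_div, abs_div, abs_of_pos hd, div_le_iff₀ hd] at h6

theorem le_abs_sub_of_lt_abs_floor_sub {d x y : ℝ} (hd : 0 < d)
    (h : 1 < |⌊x / d⌋ - ⌊y / d⌋|) : d ≤ |x - y| := by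
  have h1 := Int.floor_le (x / d)
  have h2 := Int.lt_floor_add_one (x / d)
  have h3 := Int.floor_le (y / d)
  have h4 := Int.lt_floor_add_one (y / d)
  have h5 : (2 : ℝ) ≤ |(⌊x / d⌋ : ℝ) - ⌊y / d⌋| := by exact_mod_cast h
  have h6 : 1 ≤ |x / d - y / d| := by
    rw [le_abs] at h5 ⊢
    rcases h5 with h5 | h5
    · left; linarith
    · right; linarith
  rwa [← sub_div, abs_div, abs_of_pos hd, le_div_iff₀ hd, one_mul] at h6

theorem EuclideanSpace.norm_le_sum_norm {n : ℕ} (x : Cn n) : ‖x‖ ≤ ∑ i, ‖x i‖ := by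
  rw [EuclideanSpace.norm_eq]
  exact Real.sqrt_le_left (by positivity)
    |>.2 (Finset.sum_sq_le_sq_sum_of_nonneg fun i _ => norm_nonneg _)

theorem norm_sub_le_of_mem_cubeNeighbors {n : ℕ} {d : ℝ} (hd : 0 < d) {z w : Cn n}
    (h : cubeIndex d z ∈ cubeNeighbors (cubeIndex d w)) : ‖z - w‖ ≤ n * (4 * d) := by
  rw [mem_cubeNeighbors] at h
  refine (EuclideanSpace.norm_le_sum_norm _).trans ?_
  refine (Finset.sum_le_card_nsmul _ _ (4 * d) fun i _ => ?_).trans_eq (by simp)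
  have h1 := abs_sub_le_of_abs_floor_sub_le hd (h i).1
  have h2 := abs_sub_le_of_abs_floor_sub_le hd (h i).2
  have h3 := Complex.norm_le_abs_re_add_abs_im ((z - w) i)
  simp only [PiLp.sub_apply, Complex.sub_re, Complex.sub_im] at h3 ⊢
  linarith

theorem le_norm_sub_of_notMem_cubeNeighbors {n : ℕ} {d : ℝ} (hd : 0 < d) {z w : Cn n}
    (h : cubeIndex d z ∉ cubeNeighbors (cubeIndex d w)) : d ≤ ‖z - w‖ := by
  rw [mem_cubeNeighbors] at h
  push Not at h
  obtain ⟨i, hi⟩ := h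
  refine le_trans ?_ (PiLp.norm_apply_le (z - w) i)
  by_cases h1 : |(cubeIndex d z i).1 - (cubeIndex d w i).1| ≤ 1
  · exact (le_abs_sub_of_lt_abs_floor_sub hd (hi h1)).trans (Complex.abs_im_le_norm ((z - w) i))
  · exact (le_abs_sub_of_lt_abs_floor_sub hd (not_le.1 h1)).trans
      (Complex.abs_re_le_norm ((z - w) i))

/-- If on each cube a function is controlled by the integral of `g` over the neighbouring cubes,
then it is controlled globally, with a constant which does not depend on the size of the cubes. -/
theorem lintegral_cubes_le {n : ℕ} (d : ℝ) {F : (Fin n → ℤ × ℤ) → Cn n → ℝ≥0∞} {g : Cn n → ℝ≥0∞}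
    (hg : Measurable g) {K : ℝ≥0∞}
    (h : ∀ j, ∫⁻ w in cubeIndex d ⁻¹' {j}, F j w ≤
      K * ∫⁻ z in cubeIndex d ⁻¹' (cubeNeighbors j : Set (Fin n → ℤ × ℤ)), g z) :
    ∫⁻ w, F (cubeIndex d w) w ≤ K * (9 ^ n * ∫⁻ z, g z) := by
  have hm := measurable_cubeIndex n d
  have hU : (Set.univ : Set (Cn n)) = ⋃ j, cubeIndex d ⁻¹' {j} := by
    ext w; simp
  have hmN : ∀ j : Fin n → ℤ × ℤ,
      MeasurableSet (cubeIndex d ⁻¹' (cubeNeighbors j : Set (Fin n → ℤ × ℤ))) :=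
    fun j => hm (Finset.measurableSet _)
  rw [← setLIntegral_univ, hU, lintegral_iUnion (fun j => hm (measurableSet_singleton j))
    (fun i j hij => Set.disjoint_left.2 fun w hi hj => hij (by
      rw [← Set.mem_singleton_iff.1 hi, ← Set.mem_singleton_iff.1 hj]))]
  calc ∑' j, ∫⁻ w in cubeIndex d ⁻¹' {j}, F (cubeIndex d w) w
      = ∑' j, ∫⁻ w in cubeIndex d ⁻¹' {j}, F j w := by
        refine tsum_congr fun j => setLIntegral_congr_fun (hm (measurableSet_singleton j)) ?_
        intro w hw
        change F (cubeIndex d w) w = F j w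
        rw [Set.mem_singleton_iff.1 hw]
    _ ≤ ∑' j, K * ∫⁻ z in cubeIndex d ⁻¹' (cubeNeighbors j : Set (Fin n → ℤ × ℤ)), g z :=
        ENNReal.tsum_le_tsum h
    _ = K * ∫⁻ z : Cn n, ∑' j : Fin n → ℤ × ℤ,
          (cubeIndex d ⁻¹' (cubeNeighbors j : Set (Fin n → ℤ × ℤ)) : Set (Cn n)).indicator g z := by
        rw [ENNReal.tsum_mul_left, lintegral_tsum fun j => (hg.indicator (hmN j)).aemeasurable]
        simp only [lintegral_indicator (hmN _)]
    _ = K * ∫⁻ z, 9 ^ n * g z := by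
        congr 2
        funext z
        -- Being neighbours is symmetric, so z lies in exactly 9ⁿ of the neighbourhoods.
        rw [tsum_eq_sum (s := cubeNeighbors (cubeIndex d z)) fun j hj => ?_]
        · rw [Finset.sum_congr rfl (g := fun _ => g z) fun j hj => ?_]
          · rw [Finset.sum_const, card_cubeNeighbors, nsmul_eq_mul]
            norm_cast
          · exact Set.indicator_of_mem (show z ∈ cubeIndex d ⁻¹'
              (cubeNeighbors j : Set (Fin n → ℤ × ℤ)) from mem_cubeNeighbors_comm.1 hj) _
        · exact Set.indicator_of_notMem (show z ∉ cubeIndex d ⁻¹'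
            (cubeNeighbors j : Set (Fin n → ℤ × ℤ)) from
              fun h' => hj (mem_cubeNeighbors_comm.1 h')) _
    _ = K * (9 ^ n * ∫⁻ z, g z) := by rw [lintegral_const_mul _ hg]

end Cubes

/-! ### Smallness of the operator near infinity -/

namespace FockSpace

variable {n : ℕ} {p : ℝ≥0∞}

theorem enorm_fockWeighted_add_le (f g : FockSpace n p) (w : Cn n) :
    ‖fockWeighted (f + g : FockSpace n p) w‖ₑ ≤ ‖fockWeighted f w‖ₑ + ‖fockWeighted g w‖ₑ := by
  have : fockWeighted (f + g : FockSpace n p) w = fockWeighted f w + fockWeighted g w :=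
    add_mul (f w) (g w) _
  rw [this]
  exact enorm_add_le _ _

variable [Fact (1 ≤ p)]

/-- The set of points whose cube touches the cube of index `j`. -/
def cubeNhd (d : ℝ) (j : Fin n → ℤ × ℤ) : Set (Cn n) :=
  cubeIndex d ⁻¹' (cubeNeighbors j : Set (Fin n → ℤ × ℤ))

theorem measurableSet_cubeNhd (d : ℝ) (j : Fin n → ℤ × ℤ) : MeasurableSet (cubeNhd d j) :=
  measurable_cubeIndex n d (Finset.measurableSet _)

theorem isBounded_cubeNhd {d : ℝ} (hd : 0 < d) (w : Cn n) :
    Bornology.IsBounded (cubeNhd d (cubeIndex d w)) :=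
  (Metric.isBounded_closedBall (x := w) (r := n * (4 * d))).subset fun _ hz =>
    mem_closedBall_iff_norm.2 (norm_sub_le_of_mem_cubeNeighbors hd hz)

/-- The function which on each cube is `U P_Q f`, with `Q` the neighbourhood of the cube. -/
noncomputable def cubeProj (d : ℝ) (U : FockSpace n p →L[ℂ] FockSpace n p) (f : FockSpace n p)
    (w : Cn n) : ℝ≥0∞ :=
  ‖fockWeighted (U (partialProj (cubeNhd d (cubeIndex d w)) f)) w‖ₑ

theorem measurable_cubeProj (d : ℝ) (U : FockSpace n p →L[ℂ] FockSpace n p)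
    (f : FockSpace n p) : Measurable (cubeProj d U f) := by
  have h1 : ∀ j : Fin n → ℤ × ℤ, Measurable fun w : Cn n =>
      ‖fockWeighted (U (partialProj (cubeNhd d j) f)) w‖ₑ := fun j =>
    (U (partialProj (cubeNhd d j) f)).continuous_weighted.measurable.enorm
  exact measurable_apply_cubeIndex d h1

/-- On each cube this function comes from the single element U P_Q f, of norm at most ‖U‖ times the
Gaussian mass times the L^p norm of f on Q; bounded overlap sums the p-th powers. The constant does
not involve d. -/
theorem eLpNorm_cubeProj_le (hp : 1 < p) (htop : p ≠ ∞) {d : ℝ} (hd : 0 < d)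
    (U : FockSpace n p →L[ℂ] FockSpace n p) (f : FockSpace n p) :
    eLpNorm (cubeProj d U f) p volume ≤ ENNReal.ofReal ‖U‖ *
      (gaussianMass n * (9 ^ n : ℝ≥0∞) ^ (1 / p.toReal)) * ENNReal.ofReal ‖f‖ := by
  have h0 : p ≠ 0 := (zero_lt_one.trans hp).ne'
  have hr : 0 < p.toReal := ENNReal.toReal_pos h0 htop
  have hfm : Measurable fun z => ‖fockWeighted f z‖ₑ ^ p.toReal :=
    f.continuous_weighted.measurable.enorm.pow_const _
  have hmain := lintegral_cubes_le d
    (F := fun j w => ‖fockWeighted (U (partialProj (cubeNhd d j) f)) w‖ₑ ^ p.toReal)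
    (K := (ENNReal.ofReal ‖U‖ * gaussianMass n) ^ p.toReal) hfm fun j => by
      rcases (cubeIndex d ⁻¹' {j} : Set (Cn n)).eq_empty_or_nonempty with he | ⟨w, hw⟩
      · simp [he]
      · obtain rfl : cubeIndex d w = j := hw
        refine (setLIntegral_le_lintegral _ _).trans ?_
        have h1 := ofReal_norm_partialProj_le hp htop (isBounded_cubeNhd hd w)
          (measurableSet_cubeNhd d (cubeIndex d w)) f
        rw [eLpNorm_indicator_enorm hp htop (measurableSet_cubeNhd d _)] at h1
        rw [lintegral_enorm_rpow_eq hp htop]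
        calc ENNReal.ofReal ‖U (partialProj (cubeNhd d (cubeIndex d w)) f)‖ ^ p.toReal
            ≤ (ENNReal.ofReal ‖U‖ * (gaussianMass n * (∫⁻ z in cubeNhd d (cubeIndex d w),
                ‖fockWeighted f z‖ₑ ^ p.toReal) ^ (1 / p.toReal))) ^ p.toReal := by
              gcongr
              refine (ENNReal.ofReal_le_ofReal (U.le_opNorm _)).trans ?_
              rw [ENNReal.ofReal_mul (norm_nonneg _)]
              gcongr
          _ = _ := by
              rw [← mul_assoc, ENNReal.mul_rpow_of_nonneg _ _ hr.le, ← ENNReal.rpow_mul,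
                one_div_mul_cancel hr.ne', ENNReal.rpow_one]
              rfl
  rw [lintegral_enorm_rpow_eq hp htop] at hmain
  rw [eLpNorm_eq_lintegral_rpow_enorm_toReal h0 htop]
  simp only [enorm_eq_self]
  calc (∫⁻ w, cubeProj d U f w ^ p.toReal) ^ (1 / p.toReal)
      ≤ ((ENNReal.ofReal ‖U‖ * gaussianMass n) ^ p.toReal *
          (9 ^ n * ENNReal.ofReal ‖f‖ ^ p.toReal)) ^ (1 / p.toReal) := by
        gcongr
        exact hmain
    _ = _ := by
        have e : ∀ x : ℝ≥0∞, (x ^ p.toReal) ^ (1 / p.toReal) = x := fun x => by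
          rw [← ENNReal.rpow_mul, mul_one_div_cancel hr.ne', ENNReal.rpow_one]
        have hr' : 0 ≤ 1 / p.toReal := by positivity
        rw [ENNReal.mul_rpow_of_nonneg (_ ^ _) _ hr', ENNReal.mul_rpow_of_nonneg (9 ^ n) _ hr', e, e]
        ring

/-- The dominating convolution kernel in the estimate of `T` away from the origin. -/
noncomputable def tailKernel (n : ℕ) (η D C β d : ℝ) (u : Cn n) : ℝ≥0∞ :=
  (Metric.closedBall 0 D).indicator (fun _ => ENNReal.ofReal η) u +
    {u | d ≤ ‖u‖}.indicator (fun u => ENNReal.ofReal (C * (1 + ‖u‖) ^ (-β))) u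

theorem measurableSet_le_norm (n : ℕ) (d : ℝ) : MeasurableSet {u : Cn n | d ≤ ‖u‖} :=
  measurableSet_le measurable_const measurable_norm

theorem measurable_tailKernel (n : ℕ) (η D C β d : ℝ) : Measurable (tailKernel n η D C β d) := by
  refine Measurable.add (measurable_const.indicator Metric.isClosed_closedBall.measurableSet)
    (Measurable.indicator ?_ (measurableSet_le_norm n d))
  fun_prop

theorem lintegral_tailKernel (n : ℕ) (η D C β d : ℝ) :
    ∫⁻ u, tailKernel n η D C β d u = ENNReal.ofReal η * volume (Metric.closedBall (0 : Cn n) D) +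
      ∫⁻ u in {u : Cn n | d ≤ ‖u‖}, ENNReal.ofReal (C * (1 + ‖u‖) ^ (-β)) := by
  simp only [tailKernel]
  rw [lintegral_add_left (measurable_const.indicator Metric.isClosed_closedBall.measurableSet),
    lintegral_indicator_const Metric.isClosed_closedBall.measurableSet,
    lintegral_indicator (measurableSet_le_norm n d)]

/-- Split T f = T P_Q f + S(f - P_Q f) + (T - S) f - (T - S) P_Q f with Q the neighbourhood of the
cube of w. Points of Q are within 4nd of w, where T has kernel at most η; points outside Q are at
distance at least d, where S decays. -/
theorem enorm_apply_le_tailKernel (hp : 1 < p) (htop : p ≠ ∞)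
    {T S : FockSpace n p →L[ℂ] FockSpace n p} {β C d η ρ : ℝ} (hd : 0 < d)
    (hS : ∀ z w, ‖fockWeighted (S (fockK p z)) w‖ ≤ C / (1 + ‖z - w‖) ^ β)
    (hT : ∀ z w : Cn n, ‖z - w‖ ≤ n * (4 * d) → ρ ≤ ‖w‖ →
      ‖fockWeighted (T (fockK p z)) w‖ ≤ η) (f : FockSpace n p) {w : Cn n} (hw : ρ ≤ ‖w‖) :
    ‖fockWeighted (T f) w‖ₑ ≤
      (∫⁻ z, ‖fockWeighted f z‖ₑ * tailKernel n η (n * (4 * d)) C β d (w - z)) +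
        ‖fockWeighted ((T - S) f) w‖ₑ + cubeProj d (T - S) f w := by
  set Q := cubeNhd d (cubeIndex d w) with hQdef
  have hQ := isBounded_cubeNhd hd w
  have hQm := measurableSet_cubeNhd d (cubeIndex d w)
  have hfm : Measurable fun z => ‖fockWeighted f z‖ₑ := f.continuous_weighted.measurable.enorm
  have hdec : T f = T (partialProj Q f) + (S (f - partialProj Q f) +
      ((T - S) f + -(T - S) (partialProj Q f))) := by
    simp only [_root_.sub_apply, map_sub]
    abel
  have hneg : ‖fockWeighted (-(T - S) (partialProj Q f) : FockSpace n p) w‖ₑ =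
      cubeProj d (T - S) f w := by
    have : fockWeighted (-(T - S) (partialProj Q f) : FockSpace n p) w =
        -fockWeighted ((T - S) (partialProj Q f)) w := neg_mul _ _
    rw [this, enorm_neg, cubeProj]
  have h1 : ‖fockWeighted (T (partialProj Q f)) w‖ₑ ≤ ∫⁻ z, ‖fockWeighted f z‖ₑ *
      (Metric.closedBall (0 : Cn n) (n * (4 * d))).indicator (fun _ => ENNReal.ofReal η)
        (w - z) := by
    refine (enorm_apply_partialProj_le htop T hQ f w).trans ?_
    refine (setLIntegral_mono' hQm fun z hz => ?_).trans (setLIntegral_le_lintegral Q _)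
    have hzw := norm_sub_le_of_mem_cubeNeighbors hd hz
    rw [Set.indicator_of_mem (by rwa [mem_closedBall_zero_iff, norm_sub_rev]), ← ofReal_norm
      (fockWeighted (T (fockK p z)) w)]
    gcongr
    exact hT z w hzw hw
  have h2 : ‖fockWeighted (S (f - partialProj Q f)) w‖ₑ ≤ ∫⁻ z, ‖fockWeighted f z‖ₑ *
      {u : Cn n | d ≤ ‖u‖}.indicator (fun u => ENNReal.ofReal (C * (1 + ‖u‖) ^ (-β)))
        (w - z) := by
    refine (enorm_apply_sub_partialProj_le hp htop S hQ hQm f w).trans ?_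
    refine (setLIntegral_mono' hQm.compl fun z hz => ?_).trans (setLIntegral_le_lintegral Qᶜ _)
    have hzw : w - z ∈ {u : Cn n | d ≤ ‖u‖} := by
      rw [Set.mem_ofPred_eq, norm_sub_rev]
      exact le_norm_sub_of_notMem_cubeNeighbors hd hz
    rw [Set.indicator_of_mem hzw, ← ofReal_norm (fockWeighted (S (fockK p z)) w)]
    gcongr
    rw [Real.rpow_neg (by positivity), ← div_eq_mul_inv, norm_sub_rev]
    exact hS z w
  rw [hdec]
  refine (enorm_fockWeighted_add_le _ _ w).trans ?_
  have h3 := enorm_fockWeighted_add_le (S (f - partialProj Q f))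
    ((T - S) f + -(T - S) (partialProj Q f)) w
  have h4 := enorm_fockWeighted_add_le ((T - S) f) (-(T - S) (partialProj Q f)) w
  rw [hneg] at h4
  have hsplit : ∫⁻ z, ‖fockWeighted f z‖ₑ * tailKernel n η (n * (4 * d)) C β d (w - z) =
      (∫⁻ z, ‖fockWeighted f z‖ₑ *
        (Metric.closedBall (0 : Cn n) (n * (4 * d))).indicator (fun _ => ENNReal.ofReal η)
          (w - z)) + ∫⁻ z, ‖fockWeighted f z‖ₑ *
        {u : Cn n | d ≤ ‖u‖}.indicator (fun u => ENNReal.ofReal (C * (1 + ‖u‖) ^ (-β)))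
          (w - z) := by
    simp only [tailKernel, mul_add]
    refine lintegral_add_left (hfm.mul ?_) _
    exact (measurable_const.indicator Metric.isClosed_closedBall.measurableSet).comp
      (measurable_const.sub measurable_id)
  rw [hsplit, add_assoc, add_assoc]
  gcongr
  exact h3.trans (add_le_add h2 h4)

/-- Operators in the closure of the sufficiently localized ones whose Berezin transform vanishes
at infinity are uniformly small near infinity. -/
theorem exists_eLpNorm_indicator_apply_le (hp : 1 < p) (htop : p ≠ ∞)
    (T : FockSpace n p →L[ℂ] FockSpace n p)
    (hT : T ∈ closure {S : FockSpace n p →L[ℂ] FockSpace n p | IsSufficientlyLocalized S})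
    (hB : Tendsto (berezinTransform T) (Bornology.cobounded (Cn n)) (𝓝 0)) {ε : ℝ≥0∞}
    (hε : ε ≠ 0) :
    ∃ ρ : ℝ, ∀ f : FockSpace n p,
      eLpNorm ({w : Cn n | ρ ≤ ‖w‖}.indicator (fockWeighted (T f))) p volume ≤
        ε * ENNReal.ofReal ‖f‖ := by
  have hε4 : 0 < ε / 4 := ENNReal.div_pos hε (by norm_num)
  set A : ℝ≥0∞ := gaussianMass n * (9 ^ n : ℝ≥0∞) ^ (1 / p.toReal) with hA
  have hAtop : A ≠ ∞ := ENNReal.mul_ne_top (gaussianMass_ne_top n)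
    (ENNReal.rpow_ne_top_of_nonneg (by positivity) (ENNReal.pow_ne_top (by norm_num)))
  -- Order of choices: δ, then S, then d from the tail of S, then η from the volume of the band,
  -- then ρ. This is possible because A does not depend on d. Each of four errors gets ε/4.
  obtain ⟨δ, hδ0, hδ1, hδ2⟩ : ∃ δ : ℝ, 0 < δ ∧ ENNReal.ofReal δ ≤ ε / 4 ∧
      ENNReal.ofReal δ * A ≤ ε / 4 := by
    have hpos : ∀ᶠ δ : ℝ in 𝓝[>] 0, 0 < δ := self_mem_nhdsWithin
    have h1 : Tendsto (fun δ : ℝ => ENNReal.ofReal δ) (𝓝[>] 0) (𝓝 0) :=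
      (ENNReal.continuous_ofReal.tendsto' 0 0 (by simp)).mono_left nhdsWithin_le_nhds
    have h2 : Tendsto (fun δ : ℝ => ENNReal.ofReal δ * A) (𝓝[>] 0) (𝓝 0) := by
      simpa using ENNReal.Tendsto.mul_const h1 (Or.inr hAtop)
    obtain ⟨δ, h3, h4, h5⟩ := (hpos.and
      ((h1.eventually (eventually_le_nhds hε4)).and
        (h2.eventually (eventually_le_nhds hε4)))).exists
    exact ⟨δ, h3, h4, h5⟩
  obtain ⟨S, ⟨β, C, hβ, hC, hSloc⟩, hTS⟩ := Metric.mem_closure_iff.1 hT δ hδ0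
  have hU : ENNReal.ofReal ‖T - S‖ ≤ ENNReal.ofReal δ :=
    ENNReal.ofReal_le_ofReal (by rw [← dist_eq_norm]; exact hTS.le)
  have hS : ∀ z w, ‖fockWeighted (S (fockK p z)) w‖ ≤ C / (1 + ‖z - w‖) ^ β := fun z w => by
    rw [← fockInner_normalizedKernel]
    exact hSloc z w
  -- The decay is integrable because β exceeds the real dimension 2n.
  have hint : ∫⁻ u : Cn n, ENNReal.ofReal (C * (1 + ‖u‖) ^ (-β)) ≠ ∞ := by
    have hfin : (Module.finrank ℝ (Cn n) : ℝ) < β := by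
      rw [finrank_real_of_complex]
      simpa using hβ
    exact ((integrable_one_add_norm hfin).const_mul C).lintegral_lt_top.ne
  have htail := tendsto_setLIntegral_compl_closedBall (μ := (volume : Measure (Cn n)))
    (f := fun u => ENNReal.ofReal (C * (1 + ‖u‖) ^ (-β))) (by fun_prop) hint
  obtain ⟨m, hm⟩ := (htail.eventually (eventually_le_nhds hε4)).exists
  -- Adding 1 makes d positive and puts d ≤ ‖u‖ strictly outside the closed ball of radius m.
  set d : ℝ := m + 1 with hd
  have hd0 : 0 < d := by positivity
  have hd2 : ∫⁻ u in {u : Cn n | d ≤ ‖u‖}, ENNReal.ofReal (C * (1 + ‖u‖) ^ (-β)) ≤ ε / 4 := by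
    refine (lintegral_mono_set fun u hu => ?_).trans hm
    have hu' : d ≤ ‖u‖ := hu
    simp only [Set.mem_compl_iff, mem_closedBall_zero_iff, not_le]
    linarith
  set D : ℝ := n * (4 * d)
  obtain ⟨η, hη0, hη⟩ : ∃ η : ℝ, 0 < η ∧
      ENNReal.ofReal η * volume (Metric.closedBall (0 : Cn n) D) ≤ ε / 4 := by
    have hpos : ∀ᶠ δ : ℝ in 𝓝[>] 0, 0 < δ := self_mem_nhdsWithin
    have h1 : Tendsto (fun δ : ℝ => ENNReal.ofReal δ) (𝓝[>] 0) (𝓝 0) :=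
      (ENNReal.continuous_ofReal.tendsto' 0 0 (by simp)).mono_left nhdsWithin_le_nhds
    have h2 : Tendsto (fun δ : ℝ => ENNReal.ofReal δ * volume (Metric.closedBall (0 : Cn n) D))
        (𝓝[>] 0) (𝓝 0) := by
      simpa using ENNReal.Tendsto.mul_const h1 (Or.inr measure_closedBall_lt_top.ne)
    obtain ⟨η, h3, h4⟩ := (hpos.and
      (h2.eventually (eventually_le_nhds hε4))).exists
    exact ⟨η, h3, h4⟩
  obtain ⟨ρ, hρ⟩ := exists_forall_norm_offDiagonal_le htop T hB D hη0
  refine ⟨ρ, fun f => ?_⟩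
  have hfm : Measurable fun z => ‖fockWeighted f z‖ₑ := f.continuous_weighted.measurable.enorm
  set H := tailKernel n η D C β d
  have hHm : Measurable H := measurable_tailKernel n η D C β d
  set G1 : Cn n → ℝ≥0∞ := fun w => ∫⁻ z, ‖fockWeighted f z‖ₑ * H (w - z) with hG1
  set G2 : Cn n → ℝ≥0∞ := fun w => ‖fockWeighted ((T - S) f) w‖ₑ with hG2
  have hG1m : Measurable G1 := by
    exact Measurable.lintegral_prod_right
      ((hfm.comp measurable_snd).mul (hHm.comp (measurable_fst.sub measurable_snd)))
  have hG2m : Measurable G2 := (continuous_weighted _).measurable.enorm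
  have hG3m := measurable_cubeProj d (T - S) f
  have hone : (1 : ℝ≥0∞) ≤ p := hp.le
  have b1 : eLpNorm G1 p volume ≤ (ε / 4 + ε / 4) * ENNReal.ofReal ‖f‖ := by
    refine (eLpNorm_lconvolution_le hp htop hfm hHm).trans ?_
    rw [lintegral_tailKernel, eLpNorm_enorm, eLpNorm_eq]
    gcongr
  have b2 : eLpNorm G2 p volume ≤ ε / 4 * ENNReal.ofReal ‖f‖ := by
    rw [hG2, eLpNorm_enorm, eLpNorm_eq]
    refine (ENNReal.ofReal_le_ofReal ((T - S).le_opNorm f)).trans ?_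
    rw [ENNReal.ofReal_mul (norm_nonneg _)]
    gcongr
    exact hU.trans hδ1
  have b3 : eLpNorm (cubeProj d (T - S) f) p volume ≤ ε / 4 * ENNReal.ofReal ‖f‖ := by
    refine (eLpNorm_cubeProj_le hp htop hd0 (T - S) f).trans ?_
    gcongr
    exact (mul_le_mul_left hU A).trans hδ2
  calc eLpNorm ({w : Cn n | ρ ≤ ‖w‖}.indicator (fockWeighted (T f))) p volume
      ≤ eLpNorm (G1 + G2 + cubeProj d (T - S) f) p volume := by
        refine eLpNorm_mono_enorm fun w => ?_
        rw [enorm_eq_self]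
        by_cases hw : ρ ≤ ‖w‖
        · rw [Set.indicator_of_mem (show w ∈ {w : Cn n | ρ ≤ ‖w‖} from hw)]
          exact enorm_apply_le_tailKernel hp htop hd0 hS hρ f hw
        · rw [Set.indicator_of_notMem (show w ∉ {w : Cn n | ρ ≤ ‖w‖} from hw), enorm_zero]
          exact zero_le
    _ ≤ eLpNorm G1 p volume + eLpNorm G2 p volume + eLpNorm (cubeProj d (T - S) f) p volume := by
        refine (eLpNorm_add_le (hG1m.add hG2m).aestronglyMeasurable
          hG3m.aestronglyMeasurable hone).trans ?_
        gcongr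
        exact eLpNorm_add_le hG1m.aestronglyMeasurable hG2m.aestronglyMeasurable hone
    _ ≤ (ε / 4 + ε / 4) * ENNReal.ofReal ‖f‖ + ε / 4 * ENNReal.ofReal ‖f‖ +
          ε / 4 * ENNReal.ofReal ‖f‖ := by gcongr
    _ = (ε / 2 + ε / 2) * ENNReal.ofReal ‖f‖ := by
        have : ε / 4 + ε / 4 = ε / 2 := by
          have : ε / 4 = ε / 2 / 2 := by
            rw [div_eq_mul_inv, div_eq_mul_inv, div_eq_mul_inv, mul_assoc,
              ← ENNReal.mul_inv (by norm_num) (by norm_num)]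
            norm_num
          rw [this, ENNReal.add_halves]
        rw [← add_mul, ← add_mul, add_assoc, this]
    _ = ε * ENNReal.ofReal ‖f‖ := by rw [ENNReal.add_halves]

end FockSpace

/-! ### Compactness from uniformly small tails -/

section Compact

/-- Finitely many δ-balls centred on a dense sequence cover K, and the nearest-point map to finitely
many of its terms is measurable. It serves to discretize point evaluations. -/
theorem exists_simpleFunc_dist_lt {E : Type*} [PseudoMetricSpace E] [MeasurableSpace E]
    [OpensMeasurableSpace E] [TopologicalSpace.SeparableSpace E] [Nonempty E] {K : Set E} (hK : IsCompact K) {δ : ℝ}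
    (hδ : 0 < δ) : ∃ s : SimpleFunc E E, ∀ x ∈ K, dist (s x) x < δ := by
  obtain ⟨t, ht⟩ := hK.elim_finite_subcover
    (fun k : ℕ => Metric.ball (TopologicalSpace.denseSeq E k) δ) (fun _ => Metric.isOpen_ball)
    fun x _ => Set.mem_iUnion.2 ((TopologicalSpace.denseRange_denseSeq E).exists_dist_lt x hδ)
  refine ⟨SimpleFunc.nearestPt (TopologicalSpace.denseSeq E) (t.sup id), fun x hx => ?_⟩
  obtain ⟨k, hk, hxk⟩ := Set.mem_iUnion₂.1 (ht hx)
  have h := SimpleFunc.edist_nearestPt_le (TopologicalSpace.denseSeq E) x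
    (Finset.le_sup (f := id) hk)
  rw [edist_dist, edist_dist] at h
  have h2 := (ENNReal.ofReal_le_ofReal_iff dist_nonneg).1 h
  exact h2.trans_lt (by rw [dist_comm]; exact hxk)

theorem isCompactOperator_smulRight {E F : Type*} [NormedAddCommGroup E] [NormedSpace ℂ E]
    [NormedAddCommGroup F] [NormedSpace ℂ F] (L : E →L[ℂ] ℂ) (v : F) :
    IsCompactOperator (L.smulRight v) :=
  (isCompactOperator_of_locallyCompactSpace_dom L).clm_comp (ContinuousLinearMap.toSpanSingleton ℂ v)

end Compact

namespace FockSpace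

variable {n : ℕ} {p : ℝ≥0∞} [Fact (1 ≤ p)]

/-- Restriction to a ball is approximated by compact operators from `Fᵖ` to `Lᵖ`. -/
theorem exists_isCompactOperator_approx (hp : 1 < p) (htop : p ≠ ∞) (ρ : ℝ) {ε : ℝ≥0∞}
    (hε : ε ≠ 0) :
    ∃ A : FockSpace n p →L[ℂ] Lp ℂ p (volume : Measure (Cn n)), IsCompactOperator A ∧
      ∀ g : FockSpace n p, eLpNorm ({w : Cn n | ρ ≤ ‖w‖}ᶜ.indicator (fockWeighted g) -
        (A g : Cn n → ℂ)) p volume ≤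
          ε * ENNReal.ofReal ‖g‖ := by
  have h0 : p ≠ 0 := (zero_lt_one.trans hp).ne'
  set B : Set (Cn n) := {w : Cn n | ρ ≤ ‖w‖}ᶜ with hBdef
  have hBm : MeasurableSet B := (measurableSet_le_norm n ρ).compl
  have hBK : B ⊆ Metric.closedBall 0 ρ := fun w hw => by
    rw [mem_closedBall_zero_iff]
    exact (not_le.1 (show ¬ρ ≤ ‖w‖ from hw)).le
  have hBfin : volume B ≠ ∞ := (measure_mono hBK |>.trans_lt measure_closedBall_lt_top).ne
  have hV : volume B ^ (1 / p.toReal) ≠ ∞ := ENNReal.rpow_ne_top_of_nonneg (by positivity) hBfin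
  obtain ⟨η, hη0, hη⟩ : ∃ η : ℝ, 0 < η ∧ ENNReal.ofReal η * volume B ^ (1 / p.toReal) ≤ ε := by
    have hpos : ∀ᶠ δ : ℝ in 𝓝[>] 0, 0 < δ := self_mem_nhdsWithin
    have h1 : Tendsto (fun δ : ℝ => ENNReal.ofReal δ) (𝓝[>] 0) (𝓝 0) :=
      (ENNReal.continuous_ofReal.tendsto' 0 0 (by simp)).mono_left nhdsWithin_le_nhds
    have h2 : Tendsto (fun δ : ℝ => ENNReal.ofReal δ * volume B ^ (1 / p.toReal))
        (𝓝[>] 0) (𝓝 0) := by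
      simpa using ENNReal.Tendsto.mul_const h1 (Or.inr hV)
    exact (hpos.and (h2.eventually (eventually_le_nhds (pos_iff_ne_zero.2 hε)))).exists
  have hK := isCompact_closedBall (0 : Cn n) ρ
  have hK1 := isCompact_closedBall (0 : Cn n) (ρ + 1)
  -- The radius ρ + 1 leaves room for the approximating points s w, which are moved by less than min
  -- δ 1.
  obtain ⟨δ, hδ0, hδ⟩ := Metric.uniformContinuousOn_iff.1
    (hK1.uniformContinuousOn_of_continuous
      (continuous_evalWeighted (n := n) hp).continuousOn) η hη0
  obtain ⟨s, hs⟩ := exists_simpleFunc_dist_lt hK (lt_min hδ0 one_pos)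
  have hBs : ∀ y, MeasurableSet (B ∩ s ⁻¹' {y}) := fun y => hBm.inter (s.measurableSet_fiber y)
  have hBsfin : ∀ y, volume (B ∩ s ⁻¹' {y}) ≠ ∞ := fun y =>
    (measure_mono Set.inter_subset_left |>.trans_lt hBfin.lt_top).ne
  -- Finite rank: the weighted value at w is replaced by the one at s w. The error is at most η‖g‖
  -- pointwise on a set of finite volume.
  let A : FockSpace n p →L[ℂ] Lp ℂ p (volume : Measure (Cn n)) :=
    ∑ y ∈ s.range, (evalWeighted p y).smulRight (indicatorConstLp p (hBs y) (hBsfin y) (1 : ℂ))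
  have hA : IsCompactOperator A :=
    (compactOperator (RingHom.id ℂ) (FockSpace n p) (Lp ℂ p (volume : Measure (Cn n)))).sum_mem
      fun y _ => isCompactOperator_smulRight _ _
  have hAae : ∀ g : FockSpace n p, A g =ᵐ[volume] B.indicator fun w => fockWeighted g (s w) :=
    fun g => by
      have h1 : A g = ∑ y ∈ s.range, fockWeighted g y •
          indicatorConstLp p (hBs y) (hBsfin y) (1 : ℂ) := by
        simp [A]
      have h2 : ∀ᵐ w : Cn n, ∀ y ∈ s.range, (fockWeighted g y •
          indicatorConstLp p (hBs y) (hBsfin y) (1 : ℂ) : Lp ℂ p (volume : Measure (Cn n))) w =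
          fockWeighted g y * (B ∩ s ⁻¹' {y}).indicator (fun _ => (1 : ℂ)) w := by
        refine (eventually_all_finset _).2 fun y _ => ?_
        filter_upwards [Lp.coeFn_smul (fockWeighted g y)
            (indicatorConstLp p (hBs y) (hBsfin y) (1 : ℂ)),
          indicatorConstLp_coeFn (p := p) (hs := hBs y) (hμs := hBsfin y) (c := (1 : ℂ))]
          with w h3 h4
        rw [h3, Pi.smul_apply, h4, smul_eq_mul]
      rw [h1]
      filter_upwards [h2, Lp.coeFn_finsetSum s.range fun y => fockWeighted g y •
          indicatorConstLp p (hBs y) (hBsfin y) (1 : ℂ)] with w h3 h4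
      rw [h4, Finset.sum_apply, Finset.sum_congr rfl h3, Finset.sum_eq_single (s w)]
      · by_cases hw : w ∈ B <;> simp [hw]
      · intro y _ hy
        rw [Set.indicator_of_notMem, mul_zero]
        exact fun h => hy h.2.symm
      · exact fun h => (h (s.mem_range_self w)).elim
  refine ⟨A, hA, fun g => ?_⟩
  have hpt : ∀ᵐ w : Cn n, ‖(B.indicator (fockWeighted g) - (A g : Cn n → ℂ)) w‖ ≤
      ‖B.indicator (fun _ => η * ‖g‖) w‖ := by
    filter_upwards [hAae g] with w hw
    rw [Pi.sub_apply, hw]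
    by_cases hwB : w ∈ B
    · have hwK := hBK hwB
      have hd := hs w hwK
      have hws : s w ∈ Metric.closedBall (0 : Cn n) (ρ + 1) := by
        rw [mem_closedBall_zero_iff] at hwK ⊢
        have h5 := norm_le_norm_add_norm_sub w (s w)
        have h6 : ‖s w - w‖ < 1 := by
          rw [← dist_eq_norm]
          exact hd.trans_le (min_le_right _ _)
        have h7 : ‖s w‖ ≤ ‖s w - w‖ + ‖w‖ := by simpa using norm_add_le (s w - w) w
        linarith
      have h := hδ w (Metric.closedBall_subset_closedBall (by linarith) hwK) (s w) hws
        (by rw [dist_comm]; exact hd.trans_le (min_le_left _ _))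
      rw [dist_eq_norm] at h
      have h8 := (evalWeighted p w - evalWeighted p (s w)).le_opNorm g
      rw [_root_.sub_apply, evalWeighted_apply, evalWeighted_apply] at h8
      rw [Set.indicator_of_mem hwB, Set.indicator_of_mem hwB, Set.indicator_of_mem hwB,
        Real.norm_of_nonneg (by positivity)]
      exact h8.trans (by gcongr)
    · simp [hwB]
  refine (eLpNorm_mono_ae hpt).trans ?_
  rw [eLpNorm_indicator_const hBm h0 htop, Real.enorm_of_nonneg (by positivity),
    ENNReal.ofReal_mul hη0.le, mul_right_comm]
  gcongr

/-- After embedding in L^p, T splits into a uniformly small tail and a restriction to a ball, itself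
approximated by a compact A T. Compact operators are norm closed, and the closed isometric embedding
pulls compact sets back to compact sets. -/
theorem isCompactOperator_of_forall_tail_le (hp : 1 < p) (htop : p ≠ ∞)
    (T : FockSpace n p →L[ℂ] FockSpace n p)
    (h : ∀ ε : ℝ≥0∞, ε ≠ 0 → ∃ ρ : ℝ, ∀ f : FockSpace n p,
      eLpNorm ({w : Cn n | ρ ≤ ‖w‖}.indicator (fockWeighted (T f))) p volume ≤
        ε * ENNReal.ofReal ‖f‖) :
    IsCompactOperator T := by
  set ι := (toLpₗᵢ n p).toContinuousLinearMap
  have hmem : ι.comp T ∈ {A : FockSpace n p →L[ℂ] Lp ℂ p (volume : Measure (Cn n)) |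
      IsCompactOperator A} := by
    rw [← isClosed_setOfPred_isCompactOperator.closure_eq, Metric.mem_closure_iff]
    intro ε hε
    obtain ⟨ρ, hρ⟩ := h (ENNReal.ofReal (ε / 4)) (by simpa using hε)
    have hTpos : 0 < ‖T‖ + 1 := by positivity
    -- The error of A is relative to ‖T f‖, hence the division by ‖T‖; adding 1 avoids dividing by
    -- zero.
    obtain ⟨A, hA, hAb⟩ := exists_isCompactOperator_approx (n := n) hp htop ρ
      (ε := ENNReal.ofReal (ε / 4 / (‖T‖ + 1))) (by
        rw [ne_eq, ENNReal.ofReal_eq_zero, not_le]; positivity)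
    refine ⟨A.comp T, hA.comp_clm T, ?_⟩
    rw [dist_eq_norm]
    refine (ContinuousLinearMap.opNorm_le_bound _ (by positivity : 0 ≤ ε / 2)
      fun f => ?_).trans_lt (half_lt_self hε)
    have hBm := measurableSet_le_norm n ρ
    have hTm := (T f).memLp
    have hcoe : ((ι.comp T - A.comp T) f : Cn n → ℂ) =ᵐ[volume]
        {w : Cn n | ρ ≤ ‖w‖}.indicator (fockWeighted (T f)) +
          ({w : Cn n | ρ ≤ ‖w‖}ᶜ.indicator (fockWeighted (T f)) - (A (T f) : Cn n → ℂ)) := by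
      filter_upwards [Lp.coeFn_sub (toLpₗᵢ n p (T f)) (A (T f)), coeFn_toLpₗᵢ (T f)] with w h1 h2
      change (toLpₗᵢ n p (T f) - A (T f) : Lp ℂ p (volume : Measure (Cn n))) w = _
      rw [h1, Pi.sub_apply, h2, ← add_sub_assoc, Set.indicator_self_add_compl]
      rfl
    rw [Lp.norm_def]
    refine ENNReal.toReal_le_of_le_ofReal (by positivity) ?_
    rw [eLpNorm_congr_ae hcoe]
    refine (eLpNorm_add_le (hTm.indicator hBm).1
      ((hTm.indicator hBm.compl).1.sub (Lp.aestronglyMeasurable _)) hp.le).trans ?_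
    refine (add_le_add (hρ f) (hAb (T f))).trans ?_
    rw [← ENNReal.ofReal_mul (by positivity), ← ENNReal.ofReal_mul (by positivity),
      ← ENNReal.ofReal_add (by positivity) (by positivity)]
    refine ENNReal.ofReal_le_ofReal ?_
    have h1 : ε / 4 / (‖T‖ + 1) * ‖T f‖ ≤ ε / 4 * ‖f‖ := by
      rw [div_mul_eq_mul_div, div_le_iff₀ hTpos, mul_assoc]
      gcongr
      have := T.le_opNorm f
      nlinarith [norm_nonneg f]
    linarith
  obtain ⟨K, hK, hKn⟩ := hmem
  refine ⟨toLpₗᵢ n p ⁻¹' K, ?_, hKn⟩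
  exact (toLpₗᵢ n p).isometry.isClosedEmbedding.isCompact_preimage hK

end FockSpace

theorem theorem1p3 (n : ℕ) (p : ℝ≥0∞) [Fact (1 ≤ p)] (hp : 1 < p) (hp_top : p < ∞)
    (T : FockSpace n p →L[ℂ] FockSpace n p)
    (hT : T ∈ closure {S : FockSpace n p →L[ℂ] FockSpace n p | IsSufficientlyLocalized S})
    (hB : Tendsto (berezinTransform T) (Bornology.cobounded (Cn n)) (𝓝 0)) :
    IsCompactOperator T :=
  FockSpace.isCompactOperator_of_forall_tail_le hp hp_top.ne T fun _ hε =>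
    FockSpace.exists_eLpNorm_indicator_apply_le hp hp_top.ne T hT hB hε
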